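/- Let $G=(V,E)$ be a triconnected cubic (3-regular) graph with $n$ vertices, and let $\Gamma$ be a planar straight-line drawing of $G$, given by a position $\gamma_i\in\mathbb R^2$ for each $i\in V$, such that the vertices on the boundary of the convex hull of $\{\gamma_i : i\in V\}$ are exactly the vertices of a face of the drawing. A vertex is external if it lies on the outer (unbounded) face $F_0$, and internal otherwise; an edge is internal if at least one of its ends is internal. The drawing $\Gamma$ is a weighted barycenter drawing if there are symmetric weights $w_{ij}=w_{ji}$, positive on every internal edge, such that for every internal vertex $i$, with $N(i)$ its set of neighbours, $$\gamma_i=\frac{1}{\sum_{j\in N(i)}w_{ij}}\sum_{j\in N(i)}w_{ij}\gamma_j .$$ Then the weighted barycenter recognition problem for cubic graphs is solvable in linear time on the real RAM (a random access machine with unit-cost exact real arithmetic $+,-,\times,/$ with rational constants, real comparisons, addition, subtraction and comparison of integer indices, and indirect addressing): there are a program and a constant $c$ such that for all $n$ and every such $G$ and $\Gamma$ with $V=\{0,\dots,n-1\}$, given the coordinates of the vertices, the three neighbours of each vertex in an arbitrary order, and the list of the vertices of $F_0$ in an arbitrary order, the program halts after at most $c\,n$ steps and correctly answers whether $\Gamma$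 is a weighted barycenter drawing. Moreover, if the answer is yes, then it also outputs such weights $w_{ij}$ for all internal edges. -/

import Mathlib

open Set

/-! ## Straight-line drawings of plane graphs -/

namespace WeightedBarycenter

/-- The Euclidean plane. -/
abbrev Plane : Type := EuclideanSpace ℝ (Fin 2)

section Drawings

variable {V : Type*} (G : SimpleGraph V) (γ : V → Plane)

/-- `G` is triconnected: it has at least four vertices, and removing at most two vertices
leaves a connected graph. -/
def IsTriconnected [Fintype V] : Prop :=
  4 ≤ Fintype.card V ∧ ∀ S : Finset V, S.card ≤ 2 → (G.induce {v | v ∉ S}).Connected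

/-- The straight-line drawing of `G` with vertex positions `γ` is planar: distinct vertices have
distinct positions, no vertex lies in the interior of an edge, and the interiors of two distinct
edges do not meet. -/
structure IsPlanarDrawing : Prop where
  injective : Function.Injective γ
  vertex_notMem : ∀ a b v, G.Adj a b → γ v ∉ openSegment ℝ (γ a) (γ b)
  edge_disjoint : ∀ a b c d, G.Adj a b → G.Adj c d → s(a, b) ≠ s(c, d) →
    Disjoint (openSegment ℝ (γ a) (γ b)) (openSegment ℝ (γ c) (γ d))

/-- The set of points of the plane covered by the drawing. -/
def drawingSet : Set Plane :=
  range γ ∪ ⋃ (a : V) (b : V) (_ : G.Adj a b), segment ℝ (γ a) (γ b)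

/-- The faces of the drawing: the connected components of its complement in the plane. -/
def IsFace (F : Set Plane) : Prop :=
  ∃ p ∈ (drawingSet G γ)ᶜ, F = connectedComponentIn (drawingSet G γ)ᶜ p

/-- The vertices incident with the face `F`. -/
def faceVertices (F : Set Plane) : Set V := {v | γ v ∈ closure F}

/-- A vertex is external if it lies on the outer (that is, the unbounded) face. -/
def IsExternal (v : V) : Prop :=
  ∃ F, IsFace G γ F ∧ ¬ Bornology.IsBounded F ∧ v ∈ faceVertices γ F

/-- A vertex is internal if it is not external. -/
def IsInternal (v : V) : Prop := ¬ IsExternal G γ v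

/-- The vertices on (the boundary of) the convex hull of all vertex positions. -/
def hullVertices : Set V := {v | γ v ∈ frontier (convexHull ℝ (range γ))}

/-- The inputs of the weighted barycenter recognition problem: a planar straight-line drawing of
a triconnected graph such that the vertices on the convex hull are the vertices of a face. -/
structure IsRecognitionInput [Fintype V] : Prop where
  triconnected : IsTriconnected G
  planar : IsPlanarDrawing G γ
  hull_face : ∃ F, IsFace G γ F ∧ faceVertices γ F = hullVertices γ

variable [Fintype V] [DecidableRel G.Adj]

/-- The (symmetric) weights `w` are positive on every internal edge, that is, on every edge
incident with an internal vertex, and satisfy the barycenter equation at every internal vertex. -/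
structure IsBarycenterWeight (w : Sym2 V → ℝ) : Prop where
  pos : ∀ i j, G.Adj i j → IsInternal G γ i → 0 < w s(i, j)
  eq : ∀ i, IsInternal G γ i →
    γ i = (1 / ∑ j ∈ G.neighborFinset i, w s(i, j)) • ∑ j ∈ G.neighborFinset i, w s(i, j) • γ j

/-- The drawing is a weighted barycenter drawing. -/
def IsWeightedBarycenterDrawing : Prop := ∃ w : Sym2 V → ℝ, IsBarycenterWeight G γ w

end Drawings

end WeightedBarycenter

/-! ## The real random access machine

The machine has index registers and an index memory, both holding natural numbers, and real
registers and a real memory, both holding real numbers.  Registers are named by the program, memory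
cells are addressed through index registers.  Each instruction takes one unit of time.  Real
arithmetic is exact; there is no multiplication of indices, no rounding of reals, and no
conversion between reals and indices. -/

namespace RealRAM

/-- The instructions. -/
inductive Instr : Type
  /-- `ireg d := k` -/
  | iconst (d k : ℕ)
  /-- `ireg d := ireg a + ireg b` -/
  | iadd (d a b : ℕ)
  /-- `ireg d := ireg a - ireg b`, or `0` if this is negative -/
  | isub (d a b : ℕ)
  /-- `ireg d := imem[ireg a]` -/
  | iload (d a : ℕ)
  /-- `imem[ireg a] := ireg b` -/
  | istore (a b : ℕ)
  /-- `rreg d := q` -/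
  | rconst (d : ℕ) (q : ℚ)
  /-- `rreg d := rreg a + rreg b` -/
  | radd (d a b : ℕ)
  /-- `rreg d := rreg a - rreg b` -/
  | rsub (d a b : ℕ)
  /-- `rreg d := rreg a * rreg b` -/
  | rmul (d a b : ℕ)
  /-- `rreg d := rreg a / rreg b`; the machine gets stuck if `rreg b = 0` -/
  | rdiv (d a b : ℕ)
  /-- `rreg d := rmem[ireg a]` -/
  | rload (d a : ℕ)
  /-- `rmem[ireg a] := rreg b` -/
  | rstore (a b : ℕ)
  /-- continue at instruction `t` -/
  | jump (t : ℕ)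
  /-- continue at instruction `t` if `ireg a < ireg b` -/
  | ijumpLt (a b t : ℕ)
  /-- continue at instruction `t` if `rreg a < rreg b` -/
  | rjumpLt (a b t : ℕ)
  /-- stop with the given answer -/
  | halt (answer : Bool)

/-- A program is a finite list of instructions. -/
abbrev Program : Type := List Instr

/-- The state of the machine; `pc` is the position of the next instruction. -/
@[ext]
structure State : Type where
  pc : ℕ
  ireg : ℕ → ℕ
  imem : ℕ → ℕ
  rreg : ℕ → ℝ
  rmem : ℕ → ℝ

open Classical in
/-- The effect of one instruction; `none` if there is no next state. -/
noncomputable def Instr.exec (s : State) : Instr → Option State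
  | .iconst d k => some { s with pc := s.pc + 1, ireg := Function.update s.ireg d k }
  | .iadd d a b =>
      some { s with pc := s.pc + 1, ireg := Function.update s.ireg d (s.ireg a + s.ireg b) }
  | .isub d a b =>
      some { s with pc := s.pc + 1, ireg := Function.update s.ireg d (s.ireg a - s.ireg b) }
  | .iload d a =>
      some { s with pc := s.pc + 1, ireg := Function.update s.ireg d (s.imem (s.ireg a)) }
  | .istore a b =>
      some { s with pc := s.pc + 1, imem := Function.update s.imem (s.ireg a) (s.ireg b) }
  | .rconst d q => some { s with pc := s.pc + 1, rreg := Function.update s.rreg d (q : ℝ) }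
  | .radd d a b =>
      some { s with pc := s.pc + 1, rreg := Function.update s.rreg d (s.rreg a + s.rreg b) }
  | .rsub d a b =>
      some { s with pc := s.pc + 1, rreg := Function.update s.rreg d (s.rreg a - s.rreg b) }
  | .rmul d a b =>
      some { s with pc := s.pc + 1, rreg := Function.update s.rreg d (s.rreg a * s.rreg b) }
  | .rdiv d a b =>
      if s.rreg b = 0 then none
      else some { s with pc := s.pc + 1, rreg := Function.update s.rreg d (s.rreg a / s.rreg b) }
  | .rload d a =>
      some { s with pc := s.pc + 1, rreg := Function.update s.rreg d (s.rmem (s.ireg a)) }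
  | .rstore a b =>
      some { s with pc := s.pc + 1, rmem := Function.update s.rmem (s.ireg a) (s.rreg b) }
  | .jump t => some { s with pc := t }
  | .ijumpLt a b t => some { s with pc := if s.ireg a < s.ireg b then t else s.pc + 1 }
  | .rjumpLt a b t => some { s with pc := if s.rreg a < s.rreg b then t else s.pc + 1 }
  | .halt _ => none

/-- One step of the program `P`. -/
noncomputable def step (P : Program) (s : State) : Option State :=
  P[s.pc]?.bind (Instr.exec s)

/-- The state after `t` steps of the program `P`, if the machine gets that far. -/
noncomputable def run (P : Program) : ℕ → State → Option State
  | 0, s => some s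
  | t + 1, s => (step P s).bind (run P t)

/-- Started in the state `s`, the program `P` reaches after exactly `t` steps the state `s'` and
there stops with the answer `b`. -/
def HaltsIn (P : Program) (s : State) (t : ℕ) (b : Bool) (s' : State) : Prop :=
  run P t s = some s' ∧ P[s'.pc]? = some (.halt b)

end RealRAM

/-! ## Cubic recognition inputs on the machine -/

namespace WeightedBarycenter

/-- `nbr i 0`, `nbr i 1`, `nbr i 2` are the three neighbours of `i` in some order. -/
def IsNeighborTable {n : ℕ} (G : SimpleGraph (Fin n)) (nbr : Fin n → Fin 3 → Fin n) : Prop :=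
  ∀ i, Function.Injective (nbr i) ∧ range (nbr i) = G.neighborSet i

/-- `outer` lists the vertices of the outer face in some order, without repetition. -/
def IsOuterFaceList {n : ℕ} (G : SimpleGraph (Fin n)) (γ : Fin n → Plane)
    (outer : List (Fin n)) : Prop :=
  outer.Nodup ∧ ∀ v, v ∈ outer ↔ IsExternal G γ v

/-- The contents of the index memory at the start: cell `3 * i + k` holds `nbr i k`, and cell
`3 * n + l` holds entry `l` of `outer`. All other cells are `0`. -/
def inputIndex {n : ℕ} (nbr : Fin n → Fin 3 → Fin n) (outer : List (Fin n)) (a : ℕ) : ℕ :=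
  if h : a / 3 < n then (nbr ⟨a / 3, h⟩ ⟨a % 3, Nat.mod_lt _ (by norm_num)⟩ : ℕ)
  else if h : a - 3 * n < outer.length then (outer[a - 3 * n] : ℕ)
  else 0

/-- The contents of the real memory at the start: cells `2 * i` and `2 * i + 1` hold the two
coordinates of `γ i`. All other cells are `0`. -/
noncomputable def inputReal {n : ℕ} (γ : Fin n → Plane) (a : ℕ) : ℝ :=
  if h : a / 2 < n then γ ⟨a / 2, h⟩ ⟨a % 2, Nat.mod_lt _ (by norm_num)⟩ else 0

/-- The start state: index registers `0` and `1` hold the number of vertices and the number of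
vertices of the outer face, all other registers are `0`, and the memories hold the input. -/
noncomputable def initialState {n : ℕ} (γ : Fin n → Plane) (nbr : Fin n → Fin 3 → Fin n)
    (outer : List (Fin n)) : RealRAM.State where
  pc := 0
  ireg := fun r => if r = 0 then n else if r = 1 then outer.length else 0
  imem := inputIndex nbr outer
  rreg := fun _ => 0
  rmem := inputReal γ

/-- In the state `s`, the real memory holds the weights `w` of all internal edges: for each
internal vertex `i`, cell `2 * n + 3 * i + k` holds the weight of the edge from `i` to `nbr i k`. -/
def OutputsWeights {n : ℕ} (G : SimpleGraph (Fin n)) (γ : Fin n → Plane)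
    (nbr : Fin n → Fin 3 → Fin n) (w : Sym2 (Fin n) → ℝ) (s : RealRAM.State) : Prop :=
  ∀ i, IsInternal G γ i → ∀ k : Fin 3, s.rmem (2 * n + 3 * i + k) = w s(i, nbr i k)

end WeightedBarycenter

/-! Let an internal vertex have its neighbours in the directions v₀, v₁, v₂. Weights b on its edges
satisfy the barycenter equation iff ∑ bₖ vₖ = 0. In a planar drawing the three directions span the
plane, so these relations form a line, spanned by the signed areas (v₁ × v₂, v₂ × v₀, v₀ × v₁).
Positive solutions therefore exist iff the areas have one common strict sign, and they are unique up
to a positive factor (`IsBalanced.exists_areaWeight`, `IsBalanced.exists_eq_smul`).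

It remains to choose one factor per internal vertex so that both ends of every edge between internal
vertices see the same weight; an edge to an external vertex imposes no such condition. Fixing the
factor at a root determines it along a breadth-first search of the root's component among the
internal vertices. Different components can be rescaled independently
(`IsBarycenterWeight.exists_rescale`), so the choice at the root loses nothing: if barycenter
weights exist at all, some agree with the propagated ones at all visited vertices (the field
`witness` of `IsPropagation`). Hence one comparison per edge decides at the end: a mismatch excludes
barycenter weights (`IsPropagation.symmetric`), and agreement lets the local weights be glued
(`exists_isBarycenterWeight`).

The program is a term of a small structured language, compiled to machine code. Its specifications
`Meets` bound the running time and require a proposition `R` at each stop with answer `false`; here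
`R` is the nonexistence of weights. All loop bodies are loop-free, hence of constant cost, and a
loop makes at most `2 * n` complete iterations; for the propagation this follows from a potential
function. -/

/-! ## Structured programs for the real random access machine -/

namespace RealRAM

/-- The contents of registers and memories: a state without program counter. -/
@[ext]
structure Store : Type where
  ireg : ℕ → ℕ
  imem : ℕ → ℕ
  rreg : ℕ → ℝ
  rmem : ℕ → ℝ

/-- The state with store `σ` and program counter `pc`. -/
def Store.at (σ : Store) (pc : ℕ) : State := ⟨pc, σ.ireg, σ.imem, σ.rreg, σ.rmem⟩

open Classical in
/-- The effect of a non-branching instruction on the store. -/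
noncomputable def Instr.effect (σ : Store) : Instr → Option Store
  | .iconst d k => some { σ with ireg := Function.update σ.ireg d k }
  | .iadd d a b => some { σ with ireg := Function.update σ.ireg d (σ.ireg a + σ.ireg b) }
  | .isub d a b => some { σ with ireg := Function.update σ.ireg d (σ.ireg a - σ.ireg b) }
  | .iload d a => some { σ with ireg := Function.update σ.ireg d (σ.imem (σ.ireg a)) }
  | .istore a b => some { σ with imem := Function.update σ.imem (σ.ireg a) (σ.ireg b) }
  | .rconst d q => some { σ with rreg := Function.update σ.rreg d (q : ℝ) }
  | .radd d a b => some { σ with rreg := Function.update σ.rreg d (σ.rreg a + σ.rreg b) }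
  | .rsub d a b => some { σ with rreg := Function.update σ.rreg d (σ.rreg a - σ.rreg b) }
  | .rmul d a b => some { σ with rreg := Function.update σ.rreg d (σ.rreg a * σ.rreg b) }
  | .rdiv d a b =>
      if σ.rreg b = 0 then none
      else some { σ with rreg := Function.update σ.rreg d (σ.rreg a / σ.rreg b) }
  | .rload d a => some { σ with rreg := Function.update σ.rreg d (σ.rmem (σ.ireg a)) }
  | .rstore a b => some { σ with rmem := Function.update σ.rmem (σ.ireg a) (σ.rreg b) }
  -- Jumps and `halt` get no effect, so `Meets.op` says nothing about them; control flow comes from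
  -- the commands only.
  | _ => none

theorem Instr.exec_at {i : Instr} {σ σ' : Store} (pc : ℕ) (h : i.effect σ = some σ') :
    i.exec (σ.at pc) = some (σ'.at (pc + 1)) := by
  cases i <;> simp only [Instr.effect, reduceCtorEq, Option.some.injEq] at h
  case rdiv d a b =>
    by_cases hb : σ.rreg b = 0
    · simp [hb] at h
    · simp only [hb, if_false, Option.some.injEq] at h
      subst h
      simp [Instr.exec, Store.at, hb]
  all_goals subst h; rfl

theorem run_add (P : Program) (t u : ℕ) (s : State) :
    run P (t + u) s = (run P t s).bind (run P u) := by
  induction t generalizing s with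
  | zero => simp [run]
  | succ t ih =>
    rw [Nat.add_right_comm]
    simp only [run]
    cases step P s with
    | none => rfl
    | some s' => simpa using ih s'

/-- Structured programs. -/
inductive Cmd : Type
  | skip
  | fail
  | op (i : Instr)
  | seq (c d : Cmd)
  | ilt (a b : ℕ) (c d : Cmd)
  | rlt (a b : ℕ) (c d : Cmd)
  | loop (a b : ℕ) (c : Cmd)

namespace Cmd

/-- Execute a list of commands in order. -/
def block : List Cmd → Cmd
  | [] => skip
  | c :: l => seq c (block l)

/-- The number of instructions of the compiled program. -/
def size : Cmd → ℕ
  | skip => 0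
  | fail => 1
  | op _ => 1
  | seq c d => c.size + d.size
  | ilt _ _ c d => c.size + d.size + 2
  | rlt _ _ c d => c.size + d.size + 2
  | loop _ _ c => c.size + 3

/-- Compile a structured program, to be placed at position `o`. -/
def compile : Cmd → ℕ → Program
  | skip, _ => []
  | fail, _ => [.halt false]
  | op i, _ => [i]
  | seq c d, o => c.compile o ++ d.compile (o + c.size)
  -- The negative branch `d` directly follows the test. The offset 2 counts the test and the jump
  -- over `c` that ends `d`.
  | ilt a b c d, o => .ijumpLt a b (o + d.size + 2) :: (d.compile (o + 1) ++
      .jump (o + d.size + 2 + c.size) :: c.compile (o + d.size + 2))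
  | rlt a b c d, o => .rjumpLt a b (o + d.size + 2) :: (d.compile (o + 1) ++
      .jump (o + d.size + 2 + c.size) :: c.compile (o + d.size + 2))
  | loop a b c, o => .ijumpLt a b (o + 2) :: .jump (o + c.size + 3) ::
      (c.compile (o + 2) ++ [.jump o])

@[simp]
theorem length_compile (c : Cmd) (o : ℕ) : (c.compile o).length = c.size := by
  induction c generalizing o <;> simp [compile, size, *] <;> omega

/-! ### Specifications with running time, independent of the position of the code. -/

/-- The program `P` contains the instructions `l` at position `o`. -/
def Located (l P : Program) (o : ℕ) : Prop :=
  ∃ L M : Program, P = L ++ (l ++ M) ∧ L.length = o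

theorem Located.append {l l' P : Program} {o : ℕ} (h : Located (l ++ l') P o) :
    Located l P o ∧ Located l' P (o + l.length) := by
  obtain ⟨L, M, rfl, rfl⟩ := h
  exact ⟨⟨L, l' ++ M, by simp, rfl⟩, ⟨L ++ l, M, by simp, by simp⟩⟩

theorem Located.cons {i : Instr} {l P : Program} {o : ℕ} (h : Located (i :: l) P o) :
    P[o]? = some i ∧ Located l P (o + 1) := by
  obtain ⟨L, M, rfl, rfl⟩ := h
  exact ⟨by simp, ⟨L ++ [i], M, by simp, by simp⟩⟩

/-- Started in the store `σ` at position `o`, the program `P` arrives at position `e` in at most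
`T` steps in a store satisfying `Q`, unless it stops with the answer `false` and `R` holds. -/
def Arrives (R : Prop) (P : Program) (o : ℕ) (σ : Store) (T e : ℕ) (Q : Store → Prop) : Prop :=
  ∃ t ≤ T, (∃ σ', run P t (σ.at o) = some (σ'.at e) ∧ Q σ') ∨
    (R ∧ ∃ s', HaltsIn P (σ.at o) t false s')

/-- Wherever it is placed, the compiled command `c`, started in the store `σ`, reaches its end in
at most `T` steps in a store satisfying `Q`, unless it stops with the answer `false` and `R`
holds. -/
def Meets (R : Prop) (c : Cmd) (σ : Store) (T : ℕ) (Q : Store → Prop) : Prop :=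
  ∀ (P : Program) (o : ℕ), Located (c.compile o) P o → Arrives R P o σ T (o + c.size) Q

variable {R : Prop} {c d : Cmd} {σ : Store} {T T' : ℕ} {Q Q' : Store → Prop} {P : Program}

theorem Arrives.bind {o m e : ℕ} (h : Arrives R P o σ T m Q)
    (h' : ∀ σ', Q σ' → Arrives R P m σ' T' e Q') : Arrives R P o σ (T + T') e Q' := by
  obtain ⟨t, ht, ⟨σ', h, hQ⟩ | ⟨hR, s', h⟩⟩ := h
  · obtain ⟨u, hu, hs⟩ := h' σ' hQ
    refine ⟨t + u, by omega, ?_⟩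
    simpa only [HaltsIn, run_add, h, Option.bind_some] using hs
  · exact ⟨t, by omega, .inr ⟨hR, s', h⟩⟩

theorem Arrives.refl {o : ℕ} (h : Q σ) : Arrives R P o σ 0 o Q :=
  ⟨0, le_rfl, .inl ⟨σ, rfl, h⟩⟩

theorem arrives_of_exec {o e : ℕ} {i : Instr} {σ' : Store} (hP : P[o]? = some i)
    (h : i.exec (σ.at o) = some (σ'.at e)) (hQ : Q σ') : Arrives R P o σ 1 e Q := by
  have : (σ.at o).pc = o := rfl
  exact ⟨1, le_rfl, .inl ⟨σ', by simp [run, step, this, hP, h], hQ⟩⟩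

theorem Arrives.mono {o e : ℕ} (h : Arrives R P o σ T e Q) (hT : T ≤ T')
    (hQ : ∀ σ', Q σ' → Q' σ') : Arrives R P o σ T' e Q' := by
  obtain ⟨t, ht, h⟩ := h
  exact ⟨t, ht.trans hT, h.imp_left fun ⟨σ', h, h'⟩ => ⟨σ', h, hQ _ h'⟩⟩

theorem Meets.mono (h : Meets R c σ T Q) (hT : T ≤ T') (hQ : ∀ σ', Q σ' → Q' σ') :
    Meets R c σ T' Q' :=
  fun P o hP => (h P o hP).mono hT hQ

theorem Meets.skip (h : Q σ) : Meets R skip σ 0 Q :=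
  fun _ _ _ => .refl h

theorem Meets.fail (h : R) : Meets R fail σ 1 Q :=
  fun _ o hP => ⟨0, Nat.zero_le _, .inr ⟨h, σ.at o, rfl, hP.cons.1⟩⟩

theorem Meets.op {i : Instr} {σ' : Store} (h : i.effect σ = some σ') (hQ : Q σ') :
    Meets R (op i) σ 1 Q :=
  fun _ o hP => arrives_of_exec hP.cons.1 (Instr.exec_at o h) hQ

theorem Meets.seq (hc : Meets R c σ T fun σ' => Meets R d σ' T' Q) :
    Meets R (seq c d) σ (T + T') Q := by
  intro P o hP
  obtain ⟨h₁, h₂⟩ := hP.append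
  rw [length_compile] at h₂
  rw [size, ← Nat.add_assoc]
  exact (hc P o h₁).bind fun σ' h => h P _ h₂

theorem Meets.bind (hc : Meets R c σ T Q) (hd : ∀ σ', Q σ' → Meets R d σ' T' Q') :
    Meets R (.seq c d) σ (T + T') Q' :=
  .seq (hc.mono le_rfl hd)

theorem Meets.bind_skip (hc : Meets R c σ T Q) : Meets R (.seq c .skip) σ T Q :=
  hc.bind fun _ => .skip

theorem Meets.op_bind {i : Instr} {σ' : Store} (h : i.effect σ = some σ') (hd : Meets R d σ' T Q) :
    Meets R (.seq (.op i) d) σ (T + 1) Q := by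
  rw [Nat.add_comm]
  exact .seq (.op h hd)

/-- Treats `ilt` and `rlt` together: `i t` is the conditional jump to `t`, taken iff `p`. The two
extra steps are the test and the jump over the positive branch. -/
theorem meets_branch {e : Cmd} (i : ℕ → Instr) (p : Prop) [Decidable p]
    (he : ∀ o, e.compile o = i (o + d.size + 2) :: (d.compile (o + 1) ++
      .jump (o + d.size + 2 + c.size) :: c.compile (o + d.size + 2)))
    (hs : e.size = c.size + d.size + 2)
    (hi : ∀ o t, (i t).exec (σ.at o) = some (σ.at (if p then t else o + 1)))
    (hc : p → Meets R c σ T Q) (hd : ¬ p → Meets R d σ T Q) :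
    Meets R e σ (T + 2) Q := by
  intro P o hP
  rw [he] at hP
  obtain ⟨h₁, hP⟩ := hP.cons
  obtain ⟨h₂, hP⟩ := hP.append
  obtain ⟨h₃, h₄⟩ := hP.cons
  rw [length_compile] at h₃ h₄
  rw [show o + 1 + d.size + 1 = o + d.size + 2 by omega] at h₄
  have h₀ := arrives_of_exec (R := R) (Q := (· = σ)) h₁ (hi _ _) rfl
  rw [show o + e.size = o + d.size + 2 + c.size by omega]
  by_cases hp : p
  · rw [if_pos hp] at h₀
    refine (h₀.bind fun σ' h => ?_).mono (T := 1 + T) (by omega) fun _ => id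
    subst h
    exact hc hp _ _ h₄
  · rw [if_neg hp] at h₀
    refine (h₀.bind (T' := T + 1) fun σ' h => ?_).mono (by omega) fun _ => id
    subst h
    exact (hd hp _ _ h₂).bind fun σ' h => arrives_of_exec h₃ rfl h

theorem Meets.ilt {a b : ℕ} (hc : σ.ireg a < σ.ireg b → Meets R c σ T Q)
    (hd : ¬ σ.ireg a < σ.ireg b → Meets R d σ T Q) : Meets R (ilt a b c d) σ (T + 2) Q :=
  meets_branch (.ijumpLt a b) (σ.ireg a < σ.ireg b) (fun _ => rfl) rfl (fun _ _ => rfl) hc hd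

open Classical in
theorem Meets.rlt {a b : ℕ} (hc : σ.rreg a < σ.rreg b → Meets R c σ T Q)
    (hd : ¬ σ.rreg a < σ.rreg b → Meets R d σ T Q) : Meets R (rlt a b c d) σ (T + 2) Q :=
  meets_branch (.rjumpLt a b) (σ.rreg a < σ.rreg b) (fun _ => rfl) rfl
    (fun o t => by simp only [Instr.exec, Store.at]; congr) hc hd

/-- The rule for loops: `I k` is the invariant while at most `k` iterations remain. -/
theorem Meets.loop {a b B : ℕ} (I : ℕ → Store → Prop)
    (hI : ∀ k σ, I k σ → σ.ireg a < σ.ireg b → Meets R c σ B fun σ' => ∃ k' < k, I k' σ')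
    {k : ℕ} (h : I k σ) :
    Meets R (loop a b c) σ ((k + 1) * (B + 2) + 2) fun σ' =>
      (∃ k, I k σ') ∧ ¬ σ'.ireg a < σ'.ireg b := by
  intro P o hP
  obtain ⟨h₁, hP'⟩ := hP.cons
  obtain ⟨h₂, hP'⟩ := hP'.cons
  obtain ⟨h₃, h₄⟩ := hP'.append
  replace h₄ := h₄.cons.1
  rw [length_compile] at h₄
  induction k using Nat.strong_induction_on generalizing σ with
  | _ k ih =>
    have h₀ := arrives_of_exec (R := R) (Q := (· = σ)) (σ := σ) (σ' := σ)
      (e := if σ.ireg a < σ.ireg b then o + 2 else o + 1) h₁ rfl rfl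
    by_cases hlt : σ.ireg a < σ.ireg b
    · rw [if_pos hlt] at h₀
      have h₅ := (h₀.bind fun σ' hσ => hσ ▸ hI k σ h hlt _ _ h₃).bind (T' := 1)
        fun σ' hσ => arrives_of_exec (e := o) h₄ rfl hσ
      -- Each iteration costs `B + 2` steps: test, body, jump back. The bound allows for `k + 1`
      -- iterations because even at `k = 0` the body can be entered, though it can then only stop
      -- with `false`.
      refine (h₅.bind (T' := k * (B + 2) + 2) fun σ' ⟨k', hk, h'⟩ =>
        (ih k' hk h').mono (by gcongr; omega) fun _ => id).mono ?_ fun _ => id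
      rw [Nat.add_one_mul]
      omega
    · rw [if_neg hlt] at h₀
      refine (h₀.bind (T' := 1) fun σ' hσ => ?_).mono (by omega) fun _ => id
      subst hσ
      exact arrives_of_exec h₂ rfl ⟨⟨k, h⟩, hlt⟩

/-- The weakest precondition of a command without loops. -/
noncomputable def wp (R : Prop) : Cmd → Store → (Store → Prop) → Prop
  | .skip, σ, Q => Q σ
  | .fail, _, _ => R
  | .op i, σ, Q => ∃ σ', i.effect σ = some σ' ∧ Q σ'
  | .seq c d, σ, Q => wp R c σ fun σ' => wp R d σ' Q
  | .ilt a b c d, σ, Q =>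
      (σ.ireg a < σ.ireg b → wp R c σ Q) ∧ (¬ σ.ireg a < σ.ireg b → wp R d σ Q)
  | .rlt a b c d, σ, Q =>
      (σ.rreg a < σ.rreg b → wp R c σ Q) ∧ (¬ σ.rreg a < σ.rreg b → wp R d σ Q)
  | .loop _ _ _, _, _ => False

/-- A command without loops executes each of its instructions at most once. -/
theorem Meets.of_wp (h : wp R c σ Q) : Meets R c σ c.size Q := by
  induction c generalizing σ Q with
  | skip => exact .skip h
  | fail => exact .fail h
  | op i =>
    obtain ⟨σ', h, hQ⟩ := h
    exact .op h hQ
  | seq c d hc hd => exact .seq ((hc h).mono le_rfl fun _ => hd)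
  | ilt a b c d hc hd =>
    exact Meets.ilt (T := c.size + d.size) (fun hp => (hc (h.1 hp)).mono (by omega) fun _ => id)
      fun hp => (hd (h.2 hp)).mono (by omega) fun _ => id
  | rlt a b c d hc hd =>
    exact Meets.rlt (T := c.size + d.size) (fun hp => (hc (h.1 hp)).mono (by omega) fun _ => id)
      fun hp => (hd (h.2 hp)).mono (by omega) fun _ => id
  | loop => exact h.elim

end Cmd

end RealRAM

/-! ## Balanced weights at a vertex of degree three -/

namespace WeightedBarycenter

/-- Twice the signed area of the triangle `p q r`. -/
def signedArea (p q r : Plane) : ℝ :=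
  (q 0 - p 0) * (r 1 - p 1) - (q 1 - p 1) * (r 0 - p 0)

section

variable {V : Type*} {G : SimpleGraph V} {γ : V → Plane} {nbr : V → Fin 3 → V}

/-- Two edges at `i` do not point in the same direction. -/
theorem IsPlanarDrawing.direction_ne (h : IsPlanarDrawing G γ) {i j k : V} (hj : G.Adj i j)
    (hk : G.Adj i k) (hjk : j ≠ k) {c : ℝ} (hc : 0 < c) : γ k - γ i ≠ c • (γ j - γ i) := by
  intro hu
  have hne : s(i, j) ≠ s(i, k) := by
    simpa [hjk] using fun e _ => hk.ne e
  -- If the second direction is `c` times the first, the parameter `c / (1 + c)` on the first edge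
  -- and `1 / (1 + c)` on the second give the same point.
  refine Set.not_disjoint_iff.2 ⟨γ i + (c / (1 + c)) • (γ j - γ i), ?_, ?_⟩
    (h.edge_disjoint i j i k hj hk hne)
  · rw [openSegment_eq_image']
    exact ⟨c / (1 + c), ⟨by positivity, by rw [div_lt_one (by positivity)]; linarith⟩, rfl⟩
  · rw [openSegment_eq_image']
    refine ⟨1 / (1 + c), ⟨by positivity, by rw [div_lt_one (by positivity)]; linarith⟩, ?_⟩
    simp only [hu, smul_smul]
    congr 2
    ring

theorem plane_ext {p q : Plane} (h₀ : p 0 = q 0) (h₁ : p 1 = q 1) : p = q := by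
  ext d
  fin_cases d
  · exact h₀
  · exact h₁

theorem exists_smul_of_signedArea_eq_zero {p q r : Plane} (hq : q ≠ p)
    (h : signedArea p q r = 0) : ∃ c : ℝ, r - p = c • (q - p) := by
  unfold signedArea at h
  by_cases h₀ : q 0 - p 0 = 0
  · have h₁ : q 1 - p 1 ≠ 0 := fun h₁ => hq (plane_ext (sub_eq_zero.1 h₀) (sub_eq_zero.1 h₁))
    have : r 0 - p 0 = 0 := by
      rw [h₀, zero_mul, zero_sub, neg_eq_zero] at h
      exact (mul_eq_zero.1 h).resolve_left h₁
    refine ⟨(r 1 - p 1) / (q 1 - p 1), plane_ext ?_ ?_⟩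
    · simp [h₀, this]
    · simp [h₁]
  · refine ⟨(r 0 - p 0) / (q 0 - p 0), plane_ext ?_ ?_⟩
    · simp [h₀]
    · simp only [PiLp.sub_apply, PiLp.smul_apply, smul_eq_mul]
      field_simp
      linarith

/-- The three neighbours of a vertex do not all lie on one line through it. -/
theorem IsPlanarDrawing.signedArea_ne_zero (h : IsPlanarDrawing G γ) {i j k l : V}
    (hj : G.Adj i j) (hk : G.Adj i k) (hl : G.Adj i l) (hjk : j ≠ k) (hjl : j ≠ l) (hkl : k ≠ l) :
    signedArea (γ i) (γ j) (γ k) ≠ 0 ∨ signedArea (γ i) (γ j) (γ l) ≠ 0 := by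
  by_contra! hz
  have hij : γ j ≠ γ i := fun e => hj.ne (h.injective e.symm)
  obtain ⟨c, hc⟩ := exists_smul_of_signedArea_eq_zero hij hz.1
  obtain ⟨d, hd⟩ := exists_smul_of_signedArea_eq_zero hij hz.2
  -- A positive factor would make two edges overlap and a zero factor would make two vertices
  -- coincide. So both factors are negative, and then the edges to `k` and `l` point in the same
  -- direction.
  have hc₀ : c < 0 := by
    rcases lt_trichotomy c 0 with hc' | rfl | hc'
    · exact hc'
    · rw [zero_smul, sub_eq_zero] at hc
      exact absurd (h.injective hc) hk.ne'
    · exact absurd hc (h.direction_ne hj hk hjk hc')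
  have hd₀ : d < 0 := by
    rcases lt_trichotomy d 0 with hd' | rfl | hd'
    · exact hd'
    · rw [zero_smul, sub_eq_zero] at hd
      exact absurd (h.injective hd) hl.ne'
    · exact absurd hd (h.direction_ne hj hl hjl hd')
  refine h.direction_ne hk hl hkl (div_pos_of_neg_of_neg hd₀ hc₀) ?_
  rw [hd, hc, smul_smul, div_mul_cancel₀ _ hc₀.ne]

variable (γ nbr) in
/-- The weights `b` on the three edges at `i` are positive and have `γ i` as the barycenter of
its neighbours. -/
def IsBalanced (i : V) (b : Fin 3 → ℝ) : Prop :=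
  (∀ k, 0 < b k) ∧ ∀ d : Fin 2, ∑ k, b k * (γ (nbr i k) d - γ i d) = 0

variable (γ nbr) in
/-- The signed areas of the triangles formed by `i` and two of its neighbours. -/
def areaWeight (i : V) : Fin 3 → ℝ :=
  ![signedArea (γ i) (γ (nbr i 1)) (γ (nbr i 2)), signedArea (γ i) (γ (nbr i 2)) (γ (nbr i 0)),
    signedArea (γ i) (γ (nbr i 0)) (γ (nbr i 1))]

variable (γ nbr) in
/-- The weights `areaWeight`, with the sign that makes the first one nonnegative. -/
noncomputable def orientedWeight (i : V) : Fin 3 → ℝ :=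
  if areaWeight γ nbr i 0 < 0 then -areaWeight γ nbr i else areaWeight γ nbr i

theorem IsBalanced.smul {i : V} {b : Fin 3 → ℝ} (h : IsBalanced γ nbr i b) {c : ℝ} (hc : 0 < c) :
    IsBalanced γ nbr i (c • b) := by
  refine ⟨fun k => mul_pos hc (h.1 k), fun d => ?_⟩
  simp only [Pi.smul_apply, smul_eq_mul, mul_assoc, ← Finset.mul_sum, h.2, mul_zero]

/-- The identity (v₁ × v₂) v₀ + (v₂ × v₀) v₁ + (v₀ × v₁) v₂ = 0 holds for any three plane vectors,
so only the signs have to be tested. -/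
theorem isBalanced_orientedWeight {i : V} (h : ∀ k, 0 < orientedWeight γ nbr i k) :
    IsBalanced γ nbr i (orientedWeight γ nbr i) := by
  refine ⟨h, fun d => ?_⟩
  unfold orientedWeight
  split_ifs <;> fin_cases d <;>
    simp [Fin.sum_univ_three, areaWeight, signedArea] <;> ring

/-- Taking cross products of ∑ bₖ vₖ = 0 with v₂ and v₁ shows that the areas are proportional to
`b`. The factor is nonzero because the three neighbours do not lie on one line through the vertex.
-/
theorem IsBalanced.exists_areaWeight (h : IsPlanarDrawing G γ) {i : V}
    (hn : ∀ k, G.Adj i (nbr i k)) (hinj : Function.Injective (nbr i)) {b : Fin 3 → ℝ}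
    (hb : IsBalanced γ nbr i b) : ∃ κ : ℝ, κ ≠ 0 ∧ areaWeight γ nbr i = κ • b := by
  obtain ⟨hpos, hsum⟩ := hb
  have hx := hsum 0
  have hy := hsum 1
  have h₀ := hpos 0
  have h₁ := hpos 1
  have h₂ := hpos 2
  rw [Fin.sum_univ_three] at hx hy
  have e₁ : areaWeight γ nbr i 1 = areaWeight γ nbr i 0 / b 0 * b 1 := by
    field_simp
    simp only [areaWeight, signedArea, Matrix.cons_val]
    linear_combination -(γ (nbr i 2) 1 - γ i 1) * hx + (γ (nbr i 2) 0 - γ i 0) * hy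
  have e₂ : areaWeight γ nbr i 2 = areaWeight γ nbr i 0 / b 0 * b 2 := by
    field_simp
    simp only [areaWeight, signedArea, Matrix.cons_val]
    linear_combination (γ (nbr i 1) 1 - γ i 1) * hx - (γ (nbr i 1) 0 - γ i 0) * hy
  refine ⟨areaWeight γ nbr i 0 / b 0, ?_, ?_⟩
  · intro hz
    rw [hz, zero_mul] at e₁ e₂
    have := h.signedArea_ne_zero (hn 0) (hn 1) (hn 2) (hinj.ne (by decide)) (hinj.ne (by decide))
      (hinj.ne (by decide))
    simp only [areaWeight, signedArea, Matrix.cons_val] at e₁ e₂ this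
    rcases this with h | h
    · exact h e₂
    · exact h (by linarith)
  · ext k
    fin_cases k
    · simp [h₀.ne']
    · simpa using e₁
    · simpa using e₂

/-- Balanced weights at a vertex are unique up to a positive factor. -/
theorem IsBalanced.exists_eq_smul (h : IsPlanarDrawing G γ) {i : V}
    (hn : ∀ k, G.Adj i (nbr i k)) (hinj : Function.Injective (nbr i)) {b b' : Fin 3 → ℝ}
    (hb : IsBalanced γ nbr i b) (hb' : IsBalanced γ nbr i b') : ∃ κ : ℝ, 0 < κ ∧ b' = κ • b := by
  obtain ⟨κ, hκ, e⟩ := hb.exists_areaWeight h hn hinj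
  obtain ⟨κ', hκ', e'⟩ := hb'.exists_areaWeight h hn hinj
  have he : b' = (κ / κ') • b := by
    rw [div_eq_inv_mul, ← smul_smul, ← e, e', smul_smul, inv_mul_cancel₀ hκ', one_smul]
  refine ⟨κ / κ', ?_, he⟩
  have h₀ := hb'.1 0
  rw [he] at h₀
  exact pos_of_mul_pos_left h₀ (hb.1 0).le

/-- Completeness of the local test: the areas are κ times positive numbers, and the orientation
removes the sign of κ. A nonpositive oriented weight thus excludes every balanced weight at `i`. -/
theorem IsBalanced.orientedWeight_pos (h : IsPlanarDrawing G γ) {i : V}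
    (hn : ∀ k, G.Adj i (nbr i k)) (hinj : Function.Injective (nbr i)) {b : Fin 3 → ℝ}
    (hb : IsBalanced γ nbr i b) (k : Fin 3) : 0 < orientedWeight γ nbr i k := by
  obtain ⟨κ, hκ, e⟩ := hb.exists_areaWeight h hn hinj
  have h₀ := hb.1 0
  have hk := hb.1 k
  unfold orientedWeight
  rw [e]
  simp only [Pi.smul_apply, smul_eq_mul]
  rcases lt_or_gt_of_ne hκ with hκ | hκ
  · rw [if_pos (mul_neg_of_neg_of_pos hκ h₀)]
    simpa using mul_neg_of_neg_of_pos hκ hk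
  · rw [if_neg (mul_pos hκ h₀).not_gt]
    exact mul_pos hκ hk

end

/-! ## Neighbour tables and barycenter weights -/

section

variable {n : ℕ} {G : SimpleGraph (Fin n)} {γ : Fin n → Plane} {nbr : Fin n → Fin 3 → Fin n}

theorem IsNeighborTable.adj_iff (hT : IsNeighborTable G nbr) {i j : Fin n} :
    G.Adj i j ↔ ∃ k, nbr i k = j := by
  rw [← SimpleGraph.mem_neighborSet, ← (hT i).2, Set.mem_range]

theorem IsNeighborTable.adj (hT : IsNeighborTable G nbr) (i : Fin n) (k : Fin 3) :
    G.Adj i (nbr i k) :=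
  hT.adj_iff.2 ⟨k, rfl⟩

theorem IsNeighborTable.exists_reverse (hT : IsNeighborTable G nbr) (i : Fin n) (k : Fin 3) :
    ∃ k', nbr (nbr i k) k' = i :=
  hT.adj_iff.1 (hT.adj i k).symm

variable [DecidableRel G.Adj]

theorem IsNeighborTable.sum_neighborFinset (hT : IsNeighborTable G nbr) {M : Type*}
    [AddCommMonoid M] (i : Fin n) (f : Fin n → M) :
    ∑ j ∈ G.neighborFinset i, f j = ∑ k, f (nbr i k) := by
  have : G.neighborFinset i = Finset.univ.image (nbr i) := by
    ext j
    simp [hT.adj_iff]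
  rw [this, Finset.sum_image fun a _ b _ h => (hT i).1 h]

/-- Multiplying by the positive total weight turns the barycenter equation into a linear one, which
refers only to the three edges at each internal vertex. -/
theorem IsNeighborTable.isBarycenterWeight_iff (hT : IsNeighborTable G nbr)
    {w : Sym2 (Fin n) → ℝ} :
    IsBarycenterWeight G γ w ↔
      ∀ i, IsInternal G γ i → IsBalanced γ nbr i fun k => w s(i, nbr i k) := by
  have key (i : Fin n) (hpos : ∀ k, 0 < w s(i, nbr i k)) :
      γ i = (1 / ∑ j ∈ G.neighborFinset i, w s(i, j)) • ∑ j ∈ G.neighborFinset i, w s(i, j) • γ j ↔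
      ∀ d : Fin 2, ∑ k, w s(i, nbr i k) * (γ (nbr i k) d - γ i d) = 0 := by
    rw [hT.sum_neighborFinset, hT.sum_neighborFinset]
    have hW : 0 < ∑ k, w s(i, nbr i k) := Finset.sum_pos (fun k _ => hpos k) ⟨0, by simp⟩
    rw [one_div, eq_inv_smul_iff₀ hW.ne']
    have (d : Fin 2) : ∑ k, w s(i, nbr i k) * (γ (nbr i k) d - γ i d) =
        (∑ k, w s(i, nbr i k) • γ (nbr i k)) d - ((∑ k, w s(i, nbr i k)) • γ i) d := by
      simp [Fin.sum_univ_three]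
      ring
    simp only [this, sub_eq_zero]
    exact ⟨fun h d => by rw [h], fun h => plane_ext (h 0).symm (h 1).symm⟩
  constructor
  · intro h i hi
    have hpos k : 0 < w s(i, nbr i k) := h.pos _ _ (hT.adj i k) hi
    exact ⟨hpos, (key i hpos).1 (h.eq i hi)⟩
  · refine fun h => ⟨fun i j hij hi => ?_, fun i hi => (key i (h i hi).1).2 (h i hi).2⟩
    obtain ⟨k, rfl⟩ := hT.adj_iff.1 hij
    exact (h i hi).1 k

end

end WeightedBarycenter

/-! ## Propagation of weights along the graph -/

namespace WeightedBarycenter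

section

variable {n : ℕ} {G : SimpleGraph (Fin n)} {γ : Fin n → Plane} {nbr : Fin n → Fin 3 → Fin n}
  [DecidableRel G.Adj]

/-- Barycenter weights can be rescaled on the part of the graph outside a set `S` of vertices
without internal neighbours outside `S`, so as to agree with given balanced weights at `r`. -/
theorem IsBarycenterWeight.exists_rescale (hP : IsPlanarDrawing G γ) (hT : IsNeighborTable G nbr)
    {w : Sym2 (Fin n) → ℝ} (hw : IsBarycenterWeight G γ w) {S : Set (Fin n)}
    (hS : ∀ v ∈ S, ∀ k, IsInternal G γ (nbr v k) → nbr v k ∈ S) {r : Fin n}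
    (hr : IsInternal G γ r) (hrS : r ∉ S) {b : Fin 3 → ℝ} (hb : IsBalanced γ nbr r b) :
    ∃ w', IsBarycenterWeight G γ w' ∧ (∀ v ∈ S, ∀ k, w' s(v, nbr v k) = w s(v, nbr v k)) ∧
      ∀ k, w' s(r, nbr r k) = b k := by
  classical
  rw [hT.isBarycenterWeight_iff] at hw
  obtain ⟨κ, hκ, rfl⟩ := (hw r hr).exists_eq_smul hP (hT.adj r) (hT r).1 hb
  have hin : ∀ v ∈ S, ∀ k, ∃ u ∈ s(v, nbr v k), u ∈ S := fun v hv k => ⟨v, by simp, hv⟩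
  have hout : ∀ v, IsInternal G γ v → v ∉ S → ∀ k, ¬ ∃ u ∈ s(v, nbr v k), u ∈ S := by
    rintro v hv hvS k ⟨u, hu, huS⟩
    rcases Sym2.mem_iff.1 hu with rfl | rfl
    · exact hvS huS
    · obtain ⟨k', hk'⟩ := hT.exists_reverse v k
      have := hS _ huS k'
      rw [hk'] at this
      exact hvS (this hv)
  -- Scale exactly the edges that do not touch `S`. An internal vertex outside `S` has no neighbour
  -- in `S`, so all its edges are scaled, while a vertex of `S` keeps all its weights.
  refine ⟨fun e => if ∃ u ∈ e, u ∈ S then w e else κ * w e, ?_, ?_, ?_⟩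
  · rw [hT.isBarycenterWeight_iff]
    intro i hi
    by_cases hiS : i ∈ S
    · simpa only [if_pos (hin i hiS _)] using hw i hi
    · simp only [if_neg (hout i hi hiS _)]
      exact (hw i hi).smul hκ
  · exact fun v hv k => if_pos (hin v hv k)
  · exact fun k => if_neg (hout r hr hrS k)

variable (G γ nbr) in
/-- The state of the propagation: `st v` is `0` for internal vertices not yet visited, `1` for
visited ones and `2` for external ones; `out` holds the current weights; the visited vertices are
queued at `q 0, …, q (t - 1)`, the first `h` of them have only visited and external neighbours,
and the vertices below `r` are visited or external. -/
structure IsPropagation (st : Fin n → ℕ) (out : Fin n → Fin 3 → ℝ) (q : ℕ → Fin n)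
    (h t r : ℕ) : Prop where
  internal : ∀ v, st v < 2 ↔ IsInternal G γ v
  balanced : ∀ v, IsInternal G γ v → IsBalanced γ nbr v (out v)
  visited : ∀ l < t, st (q l) = 1
  queued : ∀ v, st v = 1 → ∃ l < t, q l = v
  closed : ∀ l < h, ∀ k, st (nbr (q l) k) ≠ 0
  scanned : ∀ v : Fin n, (v : ℕ) < r → st v ≠ 0
  le : h ≤ t
  -- No choice made so far can be wrong: if there are barycenter weights, some of them extend the
  -- weights at the visited vertices.
  witness : IsWeightedBarycenterDrawing G γ →
    ∃ w, IsBarycenterWeight G γ w ∧ ∀ v, st v = 1 → ∀ k, out v k = w s(v, nbr v k)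

/-- The number of internal vertices not yet visited. -/
def unvisited (st : Fin n → ℕ) : ℕ := (Finset.univ.filter fun v => st v = 0).card

theorem unvisited_update {st : Fin n → ℕ} {v : Fin n} (hv : st v = 0) :
    unvisited (Function.update st v 1) + 1 = unvisited st := by
  have : (Finset.univ.filter fun u => Function.update st v 1 u = 0) =
      (Finset.univ.filter fun u => st u = 0).erase v := by
    ext u
    by_cases hu : u = v
    · simp [hu]
    · simp [hu]
  rw [unvisited, unvisited, this, Finset.card_erase_add_one (by simpa using hv)]

theorem unvisited_le (st : Fin n → ℕ) : unvisited st ≤ n :=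
  (Finset.card_filter_le _ _).trans (by simp)

namespace IsPropagation

variable {st : Fin n → ℕ} {out : Fin n → Fin 3 → ℝ} {q : ℕ → Fin n} {h t r : ℕ}

/-- Visit the vertex `v`, with new weights `b`. -/
theorem visit (H : IsPropagation G γ nbr st out q h t r) {v : Fin n} (hv : st v = 0)
    {b : Fin 3 → ℝ} (hb : IsBalanced γ nbr v b)
    (hw : IsWeightedBarycenterDrawing G γ → ∃ w, IsBarycenterWeight G γ w ∧
      (∀ u, st u = 1 → ∀ k, out u k = w s(u, nbr u k)) ∧ ∀ k, b k = w s(v, nbr v k)) :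
    IsPropagation G γ nbr (Function.update st v 1) (Function.update out v b)
      (Function.update q t v) h (t + 1) r := by
  have hne0 (u : Fin n) (hu : st u ≠ 0) : Function.update st v 1 u ≠ 0 := by
    rwa [Function.update_of_ne (fun e => hu (by rwa [e]))]
  refine ⟨fun u => ?_, fun u hu => ?_, fun l hl => ?_, fun u hu => ?_, fun l hl k => ?_,
    fun u hu => hne0 u (H.scanned u hu), H.le.trans (Nat.le_succ _), fun hd => ?_⟩
  · rw [← H.internal]
    by_cases huv : u = v
    · simp [huv, hv]
    · simp [huv]
  · by_cases huv : u = v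
    · simpa [huv] using hb
    · simpa [huv] using H.balanced u hu
  · by_cases hlt : l = t
    · simp [hlt]
    · have := H.visited l (by omega)
      rw [Function.update_of_ne hlt, Function.update_of_ne (fun e => by simp [e, hv] at this),
        this]
  · by_cases huv : u = v
    · exact ⟨t, Nat.lt_succ_self t, by simp [huv]⟩
    · rw [Function.update_of_ne huv] at hu
      obtain ⟨l, hl, rfl⟩ := H.queued u hu
      exact ⟨l, by omega, by rw [Function.update_of_ne hl.ne]⟩
  · have := H.le
    rw [Function.update_of_ne (by omega : l ≠ t)]
    exact hne0 _ (H.closed l hl k)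
  · obtain ⟨w, hgood, hold, hnew⟩ := hw hd
    refine ⟨w, hgood, fun u hu k => ?_⟩
    by_cases huv : u = v
    · simpa [huv] using hnew k
    · rw [Function.update_of_ne huv] at hu ⊢
      exact hold u hu k

theorem skip (H : IsPropagation G γ nbr st out q h t r)
    (hr : ∀ v : Fin n, (v : ℕ) = r → st v ≠ 0) : IsPropagation G γ nbr st out q h t (r + 1) :=
  { H with scanned := fun v hv => (Nat.lt_succ_iff_lt_or_eq.1 hv).elim (H.scanned v) (hr v) }

theorem advance (H : IsPropagation G γ nbr st out q h t r) (ht : h < t)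
    (hh : ∀ k, st (nbr (q h) k) ≠ 0) : IsPropagation G γ nbr st out q (h + 1) t r :=
  { H with
    le := ht
    closed := fun l hl => by
      rcases Nat.lt_succ_iff_lt_or_eq.1 hl with hl | rfl
      · exact H.closed l hl
      · exact hh }

/-- Start to visit a new part of the graph. -/
theorem visit_root (hP : IsPlanarDrawing G γ) (hT : IsNeighborTable G nbr)
    (H : IsPropagation G γ nbr st out q t t r) {v : Fin n} (hv : st v = 0) :
    IsPropagation G γ nbr (Function.update st v 1) out (Function.update q t v) t (t + 1) r := by
  have hvi : IsInternal G γ v := (H.internal v).1 (by omega)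
  have := H.visit hv (H.balanced v hvi) fun hd => by
    obtain ⟨w, hw, hout⟩ := H.witness hd
    -- The queue is exhausted, so internal neighbours of visited vertices are visited. The witness
    -- may therefore be rescaled off the visited set to match the weights that the root already has.
    obtain ⟨w', hw', h₁, h₂⟩ := hw.exists_rescale hP hT (S := {u | st u = 1})
      (fun u hu k hk => by
        obtain ⟨l, hl, rfl⟩ := H.queued u hu
        have h₁ := H.closed l hl k
        have h₂ := (H.internal _).2 hk
        simp only [Set.mem_ofPred_eq]
        omega) hvi (by simp [hv]) (H.balanced v hvi)
    exact ⟨w', hw', fun u hu k => (hout u hu k).trans (h₁ u hu k).symm, fun k => (h₂ k).symm⟩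
  rwa [Function.update_eq_self] at this

/-- Visit the neighbour `v` of a visited vertex `u`. -/
theorem visit_neighbor (hP : IsPlanarDrawing G γ) (hT : IsNeighborTable G nbr)
    (H : IsPropagation G γ nbr st out q h t r) {u v : Fin n} {k k' : Fin 3} (hu : st u = 1)
    (hk : nbr u k = v) (hk' : nbr v k' = u) (hv : st v = 0) :
    IsPropagation G γ nbr (Function.update st v 1)
      (Function.update out v ((out u k / out v k') • out v))
      (Function.update q t v) h (t + 1) r := by
  have hvb := H.balanced v ((H.internal v).1 (by omega))
  have hub := H.balanced u ((H.internal u).1 (by omega))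
  refine H.visit hv (hvb.smul (div_pos (hub.1 k) (hvb.1 k'))) fun hd => ?_
  obtain ⟨w, hw, hout⟩ := H.witness hd
  refine ⟨w, hw, hout, fun l => ?_⟩
  have hwv := hT.isBarycenterWeight_iff.1 hw v ((H.internal v).1 (by omega))
  -- At `v` the witness is κ times the current weights. On the edge to `u` it equals `out u k`,
  -- which forces κ to be the factor used by the update.
  obtain ⟨κ, hκ, e⟩ := hvb.exists_eq_smul hP (hT.adj v) (hT v).1 hwv
  have e' := congrFun e k'
  have el := congrFun e l
  simp only [Pi.smul_apply, smul_eq_mul] at e' el ⊢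
  rw [hout u hu k, hk, el]
  rw [hk', Sym2.eq_swap] at e'
  rw [e', mul_div_cancel_right₀ _ (hvb.1 k').ne']

/-- After the propagation, the weights of a weighted barycenter drawing are symmetric. -/
theorem symmetric (H : IsPropagation G γ nbr st out q h t r)
    (hr : n ≤ r) (hd : IsWeightedBarycenterDrawing G γ) {u v : Fin n} {k k' : Fin 3}
    (hu : st u < 2) (hv : st v < 2) (hk : nbr u k = v) (hk' : nbr v k' = u) :
    out u k = out v k' := by
  obtain ⟨w, -, hw⟩ := H.witness hd
  have h₁ := H.scanned u (by omega)
  have h₂ := H.scanned v (by omega)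
  rw [hw u (by omega), hw v (by omega), hk, hk', Sym2.eq_swap]

end IsPropagation

/-- Symmetric balanced weights at the internal vertices are barycenter weights. -/
theorem exists_isBarycenterWeight (hT : IsNeighborTable G nbr) {out : Fin n → Fin 3 → ℝ}
    (hb : ∀ v, IsInternal G γ v → IsBalanced γ nbr v (out v))
    (hs : ∀ u k k', IsInternal G γ u → IsInternal G γ (nbr u k) → nbr (nbr u k) k' = u →
      out u k = out (nbr u k) k') :
    ∃ w, IsBarycenterWeight G γ w ∧
      ∀ v, IsInternal G γ v → ∀ k, out v k = w s(v, nbr v k) := by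
  classical
  -- An edge takes the weight seen from an internal end; symmetry makes this independent of the end.
  -- Edges without an internal end get the irrelevant value 0.
  let P (e : Sym2 (Fin n)) (x : ℝ) : Prop :=
    ∃ v k, IsInternal G γ v ∧ e = s(v, nbr v k) ∧ x = out v k
  have huniq {e x y} (hx : P e x) (hy : P e y) : x = y := by
    obtain ⟨v, k, hv, rfl, rfl⟩ := hx
    obtain ⟨u, l, hu, e, rfl⟩ := hy
    rcases Sym2.eq_iff.1 e with ⟨rfl, e⟩ | ⟨e₁, e₂⟩
    · rw [(hT v).1 e]
    · subst e₁
      exact (hs u l k hu hv e₂).symm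
  let w (e : Sym2 (Fin n)) : ℝ := if h : ∃ x, P e x then h.choose else 0
  have hw v (hv : IsInternal G γ v) k : out v k = w s(v, nbr v k) := by
    have h : ∃ x, P s(v, nbr v k) x := ⟨out v k, v, k, hv, rfl, rfl⟩
    simp only [w, dif_pos h]
    exact huniq ⟨v, k, hv, rfl, rfl⟩ h.choose_spec
  refine ⟨w, hT.isBarycenterWeight_iff.2 fun i hi => ?_, hw⟩
  simpa only [← hw i hi] using hb i hi

end

end WeightedBarycenter

/-! ## The recognition program -/

namespace WeightedBarycenter

open RealRAM RealRAM.Cmd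

/-- For neighbours `i` and `j` in the index registers `12` and `13`, write the cell of the
neighbour table that is the entry `i` of the row `j` to the index register `17`. -/
def findReverse : Cmd := block
  [.op (.iadd 17 13 13), .op (.iadd 17 17 13),
    -- Index subtraction truncates at 0, so (x - i) + (i - x) is the distance of the entry x from i,
    -- and it is below 1 iff they agree. The third entry needs no test.
    .op (.iload 18 17), .op (.isub 19 18 12), .op (.isub 18 12 18), .op (.iadd 18 18 19),
    .ilt 18 2 .skip (block
      [.op (.iadd 17 17 2),
        .op (.iload 18 17), .op (.isub 19 18 12), .op (.isub 18 12 18), .op (.iadd 18 18 19),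
        .ilt 18 2 .skip (.op (.iadd 17 17 2))])]

/-- Write cell numbers and constants to the index registers. -/
def initRegs : Cmd := block
  -- Register 2 holds 1 and register 3 holds 2: comparing a status with register 2 tests for
  -- "internal and unvisited", with register 3 for "internal". Registers 4, 5 and 6 hold the starts
  -- of the statuses, the queue and the weights; register 13 temporarily holds that of the outer
  -- face list.
  [.op (.iconst 2 1), .op (.iconst 3 2), .op (.iadd 6 0 0), .op (.iadd 13 6 0),
    .op (.iadd 4 13 1), .op (.iadd 5 4 0), .op (.iconst 7 0)]

/-- Mark an external vertex. -/
def markExternalStep : Cmd := block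
  [.op (.iadd 14 13 7), .op (.iload 14 14), .op (.iadd 14 4 14), .op (.istore 14 3),
    .op (.iadd 7 7 2)]

/-- Mark the external vertices. -/
def markExternal : Cmd := .loop 7 1 markExternalStep

/-- Load the position of the vertex in the index register `17`, relative to the point in the real
registers `0` and `1`. -/
def loadDirection (x y : ℕ) : Cmd := block
  [.op (.iadd 17 17 17), .op (.rload x 17), .op (.iadd 17 17 2), .op (.rload y 17),
    .op (.rsub x x 0), .op (.rsub y y 1)]

/-- Load the positions of the neighbours of the vertex in the index register `7`. -/
def loadNeighbors : Cmd := block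
  [.op (.iadd 15 7 7), .op (.rload 0 15), .op (.iadd 16 15 2), .op (.rload 1 16),
    .op (.iadd 15 15 7), .op (.iload 17 15), loadDirection 2 3,
    .op (.iadd 15 15 2), .op (.iload 17 15), loadDirection 4 5,
    .op (.iadd 15 15 2), .op (.iload 17 15), loadDirection 6 7]

/-- Compute the signed areas at a vertex. -/
def computeAreas : Cmd := block
  [.op (.rmul 8 4 7), .op (.rmul 9 5 6), .op (.rsub 8 8 9),
    .op (.rmul 9 6 3), .op (.rmul 10 7 2), .op (.rsub 9 9 10),
    .op (.rmul 10 2 5), .op (.rmul 11 3 4), .op (.rsub 10 10 11)]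

/-- Orient the weights at a vertex. -/
def orientWeights : Cmd := block
  [.op (.rconst 11 0),
    .rlt 8 11 (block [.op (.rsub 8 11 8), .op (.rsub 9 11 9), .op (.rsub 10 11 10)]) .skip]

/-- Stop if some weight is not positive, and write the weights otherwise. -/
def storeWeights : Cmd := block
  [.rlt 11 8 (.rlt 11 9 (.rlt 11 10 .skip .fail) .fail) .fail,
    .op (.iadd 15 7 7), .op (.iadd 15 15 7), .op (.iadd 15 6 15), .op (.rstore 15 8),
    .op (.iadd 15 15 2), .op (.rstore 15 9), .op (.iadd 15 15 2), .op (.rstore 15 10)]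

/-- Compute the weights at a vertex, if it is internal. -/
def computeWeightsStep : Cmd := block
  [.op (.iadd 14 4 7), .op (.iload 14 14),
    .ilt 14 2 (block [loadNeighbors, computeAreas, orientWeights, storeWeights]) .skip,
    .op (.iadd 7 7 2)]

/-- Compute the weights at each internal vertex. -/
def computeWeights : Cmd := .loop 7 0 computeWeightsStep

/-- Multiply the three weights at the vertex in the index register `13` by the real
register `0`. -/
def scaleWeights : Cmd := block
  [.op (.iadd 17 13 13), .op (.iadd 17 17 13), .op (.iadd 17 6 17),
    .op (.rload 1 17), .op (.rmul 1 1 0), .op (.rstore 17 1), .op (.iadd 17 17 2),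
    .op (.rload 1 17), .op (.rmul 1 1 0), .op (.rstore 17 1), .op (.iadd 17 17 2),
    .op (.rload 1 17), .op (.rmul 1 1 0), .op (.rstore 17 1)]

/-- Load neighbour `k` of the vertex in the index register `12` to the index register `13`, the
cell of its status to `15` and its status to `16`. -/
def loadNeighbor (k : ℕ) : Cmd := block
  [.op (.iadd 14 12 12), .op (.iadd 14 14 12), .op (.iconst 15 k), .op (.iadd 14 14 15),
    .op (.iload 13 14), .op (.iadd 15 4 13), .op (.iload 16 15)]

/-- Load the weights of the two orientations of an edge to the real registers `0` and `1`. -/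
def loadEdge : Cmd := block
  -- The neighbour table and the weight table use the same offset 3 * vertex + slot, so adding
  -- register 6 passes from one to the other.
  [.op (.iadd 14 6 14), .op (.rload 0 14), findReverse, .op (.iadd 17 6 17), .op (.rload 1 17)]

/-- Mark the vertex in the index register `a` as visited and queue it. -/
def enqueue (a : ℕ) : Cmd := block
  [.op (.istore 15 2), .op (.iadd 16 5 9), .op (.istore 16 a), .op (.iadd 9 9 2)]

/-- Visit neighbour `k` of the vertex in the index register `12`. -/
def visitNeighbor (k : ℕ) : Cmd := block
  [loadNeighbor k,
    .ilt 16 2 (block [enqueue 13, loadEdge, .op (.rdiv 0 0 1), scaleWeights]) .skip]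

/-- Visit the neighbours of the next queued vertex. -/
def processNext : Cmd := block
  [.op (.iadd 12 5 8), .op (.iload 12 12), visitNeighbor 0, visitNeighbor 1, visitNeighbor 2,
    .op (.iadd 8 8 2)]

/-- Visit the next vertex in the list of all vertices. -/
def scanNext : Cmd := block
  [.op (.iadd 15 4 7), .op (.iload 16 15), .ilt 16 2 (enqueue 7) .skip, .op (.iadd 7 7 2)]

/-- Compute the numbers compared in the loop condition of the propagation. -/
def loopCondition : Cmd := block [.op (.iadd 10 7 8), .op (.iadd 11 9 0)]

/-- One step of the propagation. -/
def propagateStep : Cmd := block [.ilt 8 9 processNext scanNext, loopCondition]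

/-- Propagate the weights along the graph. -/
def propagate : Cmd := block
  [.op (.iconst 7 0), .op (.iconst 8 0), .op (.iconst 9 0), loopCondition,
    .loop 10 11 propagateStep]

/-- Stop if the weights of edge `k` of the vertex in the index register `12` differ. -/
def checkEdge (k : ℕ) : Cmd := block
  [loadNeighbor k,
    -- Equality of reals is tested by two strict comparisons.
    .ilt 16 3 (block [loadEdge, .rlt 0 1 .fail .skip, .rlt 1 0 .fail .skip]) .skip]

/-- Stop if the weights at a vertex are not symmetric. -/
def checkSymmetricStep : Cmd := block
  [.op (.iconst 12 0), .op (.iadd 12 7 12), .op (.iadd 14 4 7), .op (.iload 14 14),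
    .ilt 14 3 (block [checkEdge 0, checkEdge 1, checkEdge 2]) .skip, .op (.iadd 7 7 2)]

/-- Stop if the weights are not symmetric. -/
def checkSymmetric : Cmd := block [.op (.iconst 7 0), .loop 7 0 checkSymmetricStep]

/-- The recognition algorithm. -/
def recognition : Cmd := block
  [initRegs, markExternal, .op (.iconst 7 0), computeWeights, propagate, checkSymmetric]

/-- The recognition program. -/
def recognitionProgram : Program := recognition.compile 0 ++ [.halt true]

end WeightedBarycenter

/-! ## Memory layout -/

namespace WeightedBarycenter

open RealRAM RealRAM.Cmd

section

variable {n : ℕ}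

/-- The index registers that stay fixed after the initialization. -/
structure IsRegLayout (n m : ℕ) (f : ℕ → ℕ) : Prop where
  reg0 : f 0 = n
  reg1 : f 1 = m
  reg2 : f 2 = 1
  reg3 : f 3 = 2
  reg4 : f 4 = 3 * n + m
  reg5 : f 5 = 4 * n + m
  reg6 : f 6 = 2 * n

theorem IsRegLayout.congr {m : ℕ} {f f' : ℕ → ℕ} (h : IsRegLayout n m f)
    (hf : ∀ r < 7, f' r = f r) : IsRegLayout n m f' := by
  constructor <;> rw [hf _ (by norm_num)]
  exacts [h.reg0, h.reg1, h.reg2, h.reg3, h.reg4, h.reg5, h.reg6]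

/-- The index memory holds the neighbour table and the status of each vertex. -/
structure IsIndexLayout (nbr : Fin n → Fin 3 → Fin n) (m : ℕ) (st : Fin n → ℕ) (M : ℕ → ℕ) :
    Prop where
  nbr : ∀ (i : Fin n) (k : Fin 3), M (3 * i + k) = nbr i k
  st : ∀ v : Fin n, M (3 * n + m + v) = st v

namespace IsIndexLayout

variable {nbr : Fin n → Fin 3 → Fin n} {m : ℕ} {st : Fin n → ℕ} {M : ℕ → ℕ}

theorem update_st (h : IsIndexLayout nbr m st M) (v : Fin n) (x : ℕ) :
    IsIndexLayout nbr m (Function.update st v x) (Function.update M (3 * n + m + v) x) := by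
  refine ⟨fun i k => ?_, fun u => ?_⟩
  · rw [Function.update_of_ne (by omega), h.nbr]
  · by_cases huv : u = v
    · simp [huv]
    · rw [Function.update_of_ne huv, Function.update_of_ne (by omega), h.st]

theorem update_ge (h : IsIndexLayout nbr m st M) {a : ℕ} (ha : 4 * n + m ≤ a) (x : ℕ) :
    IsIndexLayout nbr m st (Function.update M a x) := by
  refine ⟨fun i k => ?_, fun u => ?_⟩
  · rw [Function.update_of_ne (by omega), h.nbr]
  · rw [Function.update_of_ne (by omega), h.st]

end IsIndexLayout

/-- The real memory holds the positions of the vertices and the current weights. -/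
structure IsRealLayout (γ : Fin n → Plane) (out : Fin n → Fin 3 → ℝ) (M : ℕ → ℝ) : Prop where
  pos : ∀ (i : Fin n) (d : Fin 2), M (2 * i + d) = γ i d
  out : ∀ (i : Fin n) (k : Fin 3), M (2 * n + 3 * i + k) = out i k

theorem IsRealLayout.update_out {γ : Fin n → Plane} {out : Fin n → Fin 3 → ℝ} {M : ℕ → ℝ}
    (h : IsRealLayout γ out M) (v : Fin n) (b : Fin 3 → ℝ) :
    IsRealLayout γ (Function.update out v b) (Function.update (Function.update
      (Function.update M (2 * n + 3 * v) (b 0)) (2 * n + 3 * v + 1) (b 1))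
      (2 * n + 3 * v + 2) (b 2)) := by
  refine ⟨fun i d => ?_, fun u k => ?_⟩
  · rw [Function.update_of_ne (by omega), Function.update_of_ne (by omega),
      Function.update_of_ne (by omega), h.pos]
  · by_cases huv : u = v
    · subst huv
      fin_cases k <;> simp
    · have : (u : ℕ) ≠ v := fun e => huv (Fin.ext e)
      rw [Function.update_of_ne huv, Function.update_of_ne (by omega),
        Function.update_of_ne (by omega), Function.update_of_ne (by omega), h.out]

variable {nbr : Fin n → Fin 3 → Fin n} {m : ℕ} {st : Fin n → ℕ} {R : Prop} {σ : Store}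
  {Q : Store → Prop}

/-- As in the other rules of this kind, the postcondition must hold for every register contents `f`
with the stated properties, so later proofs need not know the scratch registers. -/
theorem wp_findReverse (hr : IsRegLayout n m σ.ireg) (hM : IsIndexLayout nbr m st σ.imem)
    {i j : Fin n} {k : Fin 3} (hi : σ.ireg 12 = i) (hj : σ.ireg 13 = j) (hk : nbr j k = i)
    (hinj : Function.Injective (nbr j))
    (hQ : ∀ f : ℕ → ℕ, f 17 = 3 * (j : ℕ) + k → (∀ r < 17, f r = σ.ireg r) → Q { σ with ireg := f }) :
    wp R findReverse σ Q := by
  have h₀ := hM.nbr j 0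
  have h₁ := hM.nbr j 1
  have e : (j : ℕ) + j + j = 3 * j := by omega
  simp only [Fin.isValue, Fin.val_zero, Fin.val_one, Nat.add_zero] at h₀ h₁
  have hne {k' : Fin 3} (h : k' ≠ k) : (i : ℕ) ≠ nbr j k' := fun h' => h (hinj (by
    rw [hk, Fin.ext_iff, h']))
  have heq {k' : Fin 3} (h : k' = k) : (i : ℕ) = nbr j k' := by rw [h, hk]
  simp [findReverse, block, wp, Instr.effect, hi, hj, hr.reg2, e, h₀, h₁]
  refine ⟨fun h h' => ?_, fun h => ⟨fun h' h'' => ?_, fun h' => ?_⟩⟩ <;>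
    refine hQ _ ?_ fun r hr => by simp (disch := omega) only [Function.update_of_ne]
  · obtain rfl : 0 = k := by
      by_contra hk0
      exact hne hk0 (by omega)
    simp
  · obtain rfl : 1 = k := by
      by_contra hk0
      exact hne hk0 (by omega)
    simp
  -- Entries 0 and 1 have been ruled out, which leaves slot 2.
  · obtain rfl : 2 = k := by
      fin_cases k
      · have := heq (k' := 0) rfl
        omega
      · have := heq (k' := 1) rfl
        omega
      · rfl
    simp

theorem wp_loadNeighbor (hr : IsRegLayout n m σ.ireg) (hM : IsIndexLayout nbr m st σ.imem)
    {u : Fin n} (k : Fin 3) (hu : σ.ireg 12 = u)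
    (hQ : ∀ f : ℕ → ℕ, f 13 = nbr u k → f 14 = 3 * (u : ℕ) + k →
      f 15 = 3 * n + m + nbr u k → f 16 = st (nbr u k) → (∀ r < 13, f r = σ.ireg r) →
      Q { σ with ireg := f }) :
    wp R (loadNeighbor k) σ Q := by
  have e : (u : ℕ) + u + u = 3 * u := by omega
  simp [loadNeighbor, block, wp, Instr.effect, hu, hr.reg4, e, hM.nbr, hM.st]
  refine hQ _ ?_ ?_ ?_ ?_ fun r hr => by simp (disch := omega) only [Function.update_of_ne]
  all_goals simp

theorem wp_enqueue (hr : IsRegLayout n m σ.ireg) (hM : IsIndexLayout nbr m st σ.imem)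
    {v : Fin n} {t a : ℕ} (h15 : σ.ireg 15 = 3 * n + m + v) (ha : σ.ireg a = v) (ha16 : a ≠ 16)
    (h9 : σ.ireg 9 = t)
    (hQ : ∀ f M : ℕ → ℕ, f 9 = t + 1 → (∀ r < 16, r ≠ 9 → f r = σ.ireg r) →
      IsIndexLayout nbr m (Function.update st v 1) M → M (4 * n + m + t) = v →
      (∀ l ≠ t, M (4 * n + m + l) = σ.imem (4 * n + m + l)) →
      Q { σ with ireg := f, imem := M }) :
    wp R (enqueue a) σ Q := by
  simp [enqueue, block, wp, Instr.effect, h15, ha, h9, hr.reg2, hr.reg5, ha16]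
  refine hQ _ _ ?_ (fun r hr h => ?_) ((hM.update_st v 1).update_ge (by omega) _) ?_
    fun l hl => ?_
  · simp
  · simp (disch := omega) only [Function.update_of_ne]
  · simp
  · have := v.2
    simp (disch := omega) only [Function.update_of_ne]

section

variable {γ : Fin n → Plane} {out : Fin n → Fin 3 → ℝ}

theorem wp_loadEdge (hr : IsRegLayout n m σ.ireg) (hM : IsIndexLayout nbr m st σ.imem)
    (hN : IsRealLayout γ out σ.rmem) {u v : Fin n} {k k' : Fin 3} (hu : σ.ireg 12 = u)
    (hv : σ.ireg 13 = v) (h14 : σ.ireg 14 = 3 * (u : ℕ) + k) (hk : nbr v k' = u)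
    (hinj : Function.Injective (nbr v))
    (hQ : ∀ (f : ℕ → ℕ) (g : ℕ → ℝ), g 0 = out u k → g 1 = out v k' →
      (∀ r < 14, f r = σ.ireg r) → Q { σ with ireg := f, rreg := g }) :
    wp R loadEdge σ Q := by
  have h₀ := hN.out u k
  rw [Nat.add_assoc] at h₀
  simp [loadEdge, block, wp, Instr.effect, h14, hr.reg6, h₀]
  refine wp_findReverse (hr.congr fun r hr => ?_) hM (i := u) (j := v) ?_ ?_ hk hinj
    fun f h17 hf => ?_
  · simp (disch := omega) only [Function.update_of_ne]
  · simpa using hu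
  · simpa using hv
  · have h₁ := hN.out v k'
    rw [Nat.add_assoc] at h₁
    have h6 : f 6 = 2 * n := by simp [hf, hr.reg6]
    simp only [h17, h6, h₁]
    refine hQ _ _ ?_ ?_ fun r hr => ?_
    · simp
    · simp
    · simp (disch := omega) only [Function.update_of_ne, hf]

theorem wp_scaleWeights (hr : IsRegLayout n m σ.ireg) (hN : IsRealLayout γ out σ.rmem)
    {v : Fin n} {c : ℝ} (hv : σ.ireg 13 = v) (hc : σ.rreg 0 = c)
    (hQ : ∀ (f : ℕ → ℕ) (g M : ℕ → ℝ), (∀ r < 17, f r = σ.ireg r) →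
      IsRealLayout γ (Function.update out v (c • out v)) M →
      Q { σ with ireg := f, rreg := g, rmem := M }) :
    wp R scaleWeights σ Q := by
  have e : 2 * n + ((v : ℕ) + v + v) = 2 * n + 3 * v := by omega
  have e' : 2 * n + 3 * (v : ℕ) + 1 + 1 = 2 * n + 3 * v + 2 := rfl
  have h₀ := hN.out v 0
  have h₁ := hN.out v 1
  have h₂ := hN.out v 2
  simp only [Fin.isValue, Fin.val_zero, Fin.val_one, Fin.val_two, Nat.add_zero] at h₀ h₁ h₂
  simp [scaleWeights, block, wp, Instr.effect, hv, hc, hr.reg6, hr.reg2, e, e', h₀, h₁, h₂]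
  refine hQ _ _ _ (fun r hr => by simp (disch := omega) only [Function.update_of_ne]) ?_
  convert hN.update_out v (c • out v) using 2 <;> simp [mul_comm]

end

end

end WeightedBarycenter

/-! ## Correctness of the propagation -/

namespace WeightedBarycenter

open RealRAM RealRAM.Cmd

section

variable {n : ℕ} {G : SimpleGraph (Fin n)} {γ : Fin n → Plane} {nbr : Fin n → Fin 3 → Fin n}
  [DecidableRel G.Adj] {m : ℕ} {σ : Store} {R : Prop} {Q : Store → Prop}

variable (G γ nbr m) in
/-- The store during the propagation. -/
structure IsPropStore (σ : Store) (st : Fin n → ℕ) (out : Fin n → Fin 3 → ℝ) (q : ℕ → Fin n)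
    (h t r : ℕ) : Prop where
  regs : IsRegLayout n m σ.ireg
  index : IsIndexLayout nbr m st σ.imem
  real : IsRealLayout γ out σ.rmem
  reg7 : σ.ireg 7 = r
  reg8 : σ.ireg 8 = h
  reg9 : σ.ireg 9 = t
  queue : ∀ l < t, σ.imem (4 * n + m + l) = q l
  prop : IsPropagation G γ nbr st out q h t r

variable {st : Fin n → ℕ} {out : Fin n → Fin 3 → ℝ} {q : ℕ → Fin n} {h t r : ℕ}

/-- Statuses already set and queue entries already written persist, so that three calls compose. The
sum of queue length and number of unvisited vertices is invariant, as the termination argument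
requires. -/
theorem wp_visitNeighbor (hP : IsPlanarDrawing G γ) (hT : IsNeighborTable G nbr)
    (H : IsPropStore G γ nbr m σ st out q h t r) {u : Fin n} (hu : σ.ireg 12 = u)
    (hst : st u = 1) (k : Fin 3)
    (hQ : ∀ σ' st' out' q' t', IsPropStore G γ nbr m σ' st' out' q' h t' r → σ'.ireg 12 = u →
      t' + unvisited st' = t + unvisited st → (∀ v, st v ≠ 0 → st' v = st v) →
      st' (nbr u k) ≠ 0 → t ≤ t' → (∀ l < t, q' l = q l) → Q σ') :
    wp R (visitNeighbor k) σ Q := by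
  obtain ⟨k', hk'⟩ := hT.exists_reverse u k
  refine wp_loadNeighbor H.regs H.index k hu fun f h13 h14 h15 h16 hf => ?_
  have hregs : IsRegLayout n m f := H.regs.congr fun r hr => hf r (by omega)
  refine ⟨fun hlt => ?_, fun hlt => ?_⟩
  · have hv : st (nbr u k) = 0 := by
      have h2 := hregs.reg2
      simp only at hlt
      omega
    refine wp_enqueue (σ := { σ with ireg := f }) hregs H.index h15 h13 (by norm_num) ((hf 9 (by norm_num)).trans H.reg9)
      fun f₁ M h9 hf₁ hM hMt hMl => ?_
    dsimp only at hf₁ hMl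
    have hregs₁ : IsRegLayout n m f₁ := hregs.congr fun r hr => hf₁ r (by omega) (by omega)
    have h12 : f₁ 12 = u := by rw [hf₁ 12 (by norm_num) (by norm_num), hf 12 (by norm_num), hu]
    have h13₁ : f₁ 13 = nbr u k := by rw [hf₁ 13 (by norm_num) (by norm_num), h13]
    refine wp_loadEdge (σ := { σ with ireg := f₁, imem := M }) hregs₁ hM H.real h12 h13₁
      ((hf₁ 14 (by norm_num) (by norm_num)).trans h14) hk' (hT _).1 fun f₂ g hg0 hg1 hf₂ => ?_
    have hne : g 1 ≠ 0 := by
      rw [hg1]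
      exact ((H.prop.balanced _ ((H.prop.internal _).1 (by omega))).1 k').ne'
    refine ⟨_, if_neg hne, wp_scaleWeights (σ := ⟨f₂, M, _, σ.rmem⟩) (hregs₁.congr fun r hr => hf₂ r (by omega)) H.real
      ((hf₂ 13 (by norm_num)).trans h13₁) (c := out u k / out (nbr u k) k') (by simp [hg0, hg1]) fun f₃ g₃ N hf₃ hN => ?_⟩
    have hf' (r : ℕ) (hr : r < 13) (hr9 : r ≠ 9) : f₃ r = σ.ireg r := by
      have h₁ := hf₃ r (by omega)
      simp only at h₁
      rw [h₁, hf₂ r (by omega)]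
      exact (hf₁ r (by omega) hr9).trans (hf r hr)
    have hf9 : f₃ 9 = t + 1 := by
      have h₁ := hf₃ 9 (by omega)
      simp only at h₁
      rw [h₁, hf₂ 9 (by omega)]
      exact h9
    refine hQ _ _ _ _ (t + 1) ⟨H.regs.congr fun r hr => hf' r (by omega) (by omega), hM, hN,
      (hf' 7 (by norm_num) (by norm_num)).trans H.reg7,
      (hf' 8 (by norm_num) (by norm_num)).trans H.reg8, hf9, fun l hl => ?_,
      H.prop.visit_neighbor hP hT hst rfl hk' hv⟩ ?_ ?_ ?_ ?_ ?_ ?_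
    · by_cases hlt : l = t
      · subst hlt
        simpa using hMt
      · rw [Function.update_of_ne hlt]
        exact (hMl l hlt).trans (H.queue l (by omega))
    · exact (hf' 12 (by norm_num) (by norm_num)).trans hu
    · rw [← unvisited_update hv]
      omega
    · intro v hv'
      rw [Function.update_of_ne (fun e => hv' (by rwa [e]))]
    · simp
    · omega
    · intro l hl
      rw [Function.update_of_ne hl.ne]
  · have h2 := hregs.reg2
    simp only at hlt
    refine hQ _ st out q t ⟨hregs, H.index, H.real, (hf 7 (by norm_num)).trans H.reg7,
      (hf 8 (by norm_num)).trans H.reg8, (hf 9 (by norm_num)).trans H.reg9, H.queue, H.prop⟩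
      ((hf 12 (by norm_num)).trans hu) rfl (fun _ _ => rfl) (by omega) le_rfl fun _ _ => rfl

theorem wp_processNext (hP : IsPlanarDrawing G γ) (hT : IsNeighborTable G nbr)
    (H : IsPropStore G γ nbr m σ st out q h t r) (ht : h < t)
    (hQ : ∀ σ' st' out' q' t', IsPropStore G γ nbr m σ' st' out' q' (h + 1) t' r →
      t' + unvisited st' = t + unvisited st → Q σ') :
    wp R processNext σ Q := by
  set u := q h with hu
  have h₀ : IsPropStore G γ nbr m { σ with
      ireg := Function.update (Function.update σ.ireg 12 (4 * n + m + h)) 12 u } st out q h t r :=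
    { H with
      regs := H.regs.congr fun r hr => by simp (disch := omega) only [Function.update_of_ne]
      reg7 := by simpa using H.reg7
      reg8 := by simpa using H.reg8
      reg9 := by simpa using H.reg9 }
  have hst := H.prop.visited h ht
  rw [← hu] at hst
  refine ⟨_, rfl, _, rfl, ?_⟩
  simp only [H.regs.reg5, H.reg8, Function.update_self, H.queue h ht, ← hu]
  refine wp_visitNeighbor hP hT h₀ (by simp) hst 0
    fun σ₁ st₁ out₁ q₁ t₁ h₁ hu₁ hc₁ hst₁ hn₁ ht₁ hq₁ => ?_
  refine wp_visitNeighbor hP hT h₁ hu₁ (by rw [hst₁ u (by omega), hst]) 1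
    fun σ₂ st₂ out₂ q₂ t₂ h₂ hu₂ hc₂ hst₂ hn₂ ht₂ hq₂ => ?_
  have hu₂' : st₂ u = 1 := by rw [hst₂ u (by rw [hst₁ u] <;> omega), hst₁ u (by omega), hst]
  refine wp_visitNeighbor hP hT h₂ hu₂ hu₂' 2
    fun σ₃ st₃ out₃ q₃ t₃ h₃ hu₃ hc₃ hst₃ hn₃ ht₃ hq₃ => ?_
  have hq : q₃ h = u := by rw [hq₃ h (by omega), hq₂ h (by omega), hq₁ h ht]
  refine ⟨_, rfl, hQ _ st₃ out₃ q₃ t₃ { h₃ with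
    regs := h₃.regs.congr fun r hr => by simp (disch := omega) only [Function.update_of_ne]
    reg7 := by simpa using h₃.reg7
    reg8 := by simp [h₃.reg8, h₃.regs.reg2]
    reg9 := by simpa using h₃.reg9
    prop := h₃.prop.advance (by omega) ?_ } (by omega)⟩
  intro k
  rw [hq]
  fin_cases k
  · have h₂' := hst₂ _ hn₁
    have h₃' := hst₃ (nbr u 0) (by rwa [h₂'])
    simp only [Fin.zero_eta]
    omega
  · have h₃' := hst₃ _ hn₂
    simp only [Fin.mk_one]
    omega
  · exact hn₃

theorem wp_scanNext (hP : IsPlanarDrawing G γ) (hT : IsNeighborTable G nbr)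
    (H : IsPropStore G γ nbr m σ st out q t t r) (hr : r < n)
    (hQ : ∀ σ' st' out' q' t', IsPropStore G γ nbr m σ' st' out' q' t t' (r + 1) →
      t' + unvisited st' = t + unvisited st → Q σ') :
    wp R scanNext σ Q := by
  have hst := H.index.st ⟨r, hr⟩
  refine ⟨_, rfl, _, rfl, ?_⟩
  simp [H.regs.reg4, H.reg7, hst]
  have h₀ : IsPropStore G γ nbr m { σ with
      ireg := Function.update (Function.update σ.ireg 15 (3 * n + m + r)) 16 (st ⟨r, hr⟩) } st out q t t r :=
    { H with
      regs := H.regs.congr fun r hr => by simp (disch := omega) only [Function.update_of_ne]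
      reg7 := by simpa using H.reg7
      reg8 := by simpa using H.reg8
      reg9 := by simpa using H.reg9 }
  refine ⟨fun hlt => ?_, fun hlt => ?_⟩
  · have hv : st ⟨r, hr⟩ = 0 := by
      have h2 := H.regs.reg2
      simp at hlt
      omega
    refine wp_enqueue (v := ⟨r, hr⟩) h₀.regs h₀.index (by simp) h₀.reg7 (by norm_num) h₀.reg9
      fun f M h9 hf hM hMt hMl => ?_
    have hregs : IsRegLayout n m f := h₀.regs.congr fun r hr => hf r (by omega) (by omega)
    have hf7 : f 7 = r := (hf 7 (by norm_num) (by norm_num)).trans h₀.reg7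
    have hf8 : f 8 = t := (hf 8 (by norm_num) (by norm_num)).trans h₀.reg8
    refine ⟨_, rfl, hQ _ _ out _ (t + 1) ⟨hregs.congr fun r hr => by
      simp (disch := omega) only [Function.update_of_ne], hM, H.real, ?_, ?_, ?_, fun l hl => ?_,
      (H.prop.visit_root hP hT hv).skip ?_⟩ ?_⟩
    · simp [hf7, hregs.reg2]
    · simpa using hf8
    · simpa using h9
    · by_cases hlt : l = t
      · subst hlt
        simpa using hMt
      · rw [Function.update_of_ne hlt]
        exact (hMl l hlt).trans (H.queue l (by omega))
    · intro v hvr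
      obtain rfl : v = ⟨r, hr⟩ := Fin.ext hvr
      simp
    · rw [← unvisited_update hv]
      omega
  · refine ⟨_, rfl, hQ _ st out q t { h₀ with
      regs := h₀.regs.congr fun r hr => by simp (disch := omega) only [Function.update_of_ne]
      reg7 := by simp [H.reg7, H.regs.reg2]
      reg8 := by simpa using H.reg8
      reg9 := by simpa using H.reg9
      prop := h₀.prop.skip ?_ } rfl⟩
    intro v hvr
    obtain rfl : v = ⟨r, hr⟩ := Fin.ext hvr
    have h2 := H.regs.reg2
    simp at hlt
    omega

theorem wp_loopCondition (H : IsPropStore G γ nbr m σ st out q h t r)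
    (hQ : ∀ σ', IsPropStore G γ nbr m σ' st out q h t r → σ'.ireg 10 = r + h →
      σ'.ireg 11 = t + n → Q σ') :
    wp R loopCondition σ Q := by
  refine ⟨_, rfl, _, rfl, hQ _ { H with
      regs := H.regs.congr fun r hr => by simp (disch := omega) only [Function.update_of_ne]
      reg7 := by simpa using H.reg7
      reg8 := by simpa using H.reg8
      reg9 := by simpa using H.reg9 } ?_ ?_⟩
  · simp [H.reg7, H.reg8]
  · simp [H.reg9, H.regs.reg0]

theorem meets_propagate (hP : IsPlanarDrawing G γ) (hT : IsNeighborTable G nbr) (q : ℕ → Fin n)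
    (hr : IsRegLayout n m σ.ireg) (hM : IsIndexLayout nbr m st σ.imem)
    (hN : IsRealLayout γ out σ.rmem) (hst : ∀ v, st v = 0 ∨ st v = 2)
    (hi : ∀ v, st v = 0 ↔ IsInternal G γ v)
    (hb : ∀ v, IsInternal G γ v → IsBalanced γ nbr v (out v)) :
    Meets R propagate σ ((2 * n + 1) * (propagateStep.size + 2) + 7)
      fun σ' => ∃ st out q h t r, IsPropStore G γ nbr m σ' st out q h t r ∧ n ≤ r := by
  have h₀ : IsPropStore G γ nbr m { σ with
      ireg := Function.update (Function.update (Function.update σ.ireg 7 0) 8 0) 9 0 } st out q 0 0 0 :=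
    { regs := hr.congr fun r hr => by simp (disch := omega) only [Function.update_of_ne]
      index := hM
      real := hN
      reg7 := by simp
      reg8 := by simp
      reg9 := by simp
      queue := by simp
      prop :=
        { internal := fun v => by rw [← hi]; have := hst v; omega
          balanced := hb
          visited := by simp
          queued := fun v hv => by have := hst v; omega
          closed := by simp
          scanned := by simp
          le := le_rfl
          witness := fun ⟨w, hw⟩ => ⟨w, hw, fun v hv => by have := hst v; omega⟩ } }
  -- The potential counts vertices to scan, queued vertices to process and unvisited vertices.
  -- Processing raises `h` and scanning raises `r`, while `t + unvisited` is constant, so each step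
  -- lowers it by one from at most `2 * n`. The loop test `r + h < t + n` fails only if `n ≤ r`,
  -- since `h ≤ t`.
  let I (k : ℕ) (σ : Store) : Prop := ∃ st out q h t r, IsPropStore G γ nbr m σ st out q h t r ∧
    σ.ireg 10 = r + h ∧ σ.ireg 11 = t + n ∧ (n - r) + (t - h) + unvisited st ≤ k
  have hloop (k : ℕ) (σ : Store) (hσ : I k σ) (hlt : σ.ireg 10 < σ.ireg 11) :
      Meets R propagateStep σ propagateStep.size
        fun σ' => ∃ k' < k, I k' σ' := by
    obtain ⟨st, out, q, h, t, r, H, h10, h11, hk⟩ := hσ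
    refine .of_wp ⟨fun hht => ?_, fun hht => ?_⟩
    · rw [H.reg8, H.reg9] at hht
      refine wp_processNext hP hT H hht fun σ₁ st₁ out₁ q₁ t₁ H₁ hc => ?_
      refine wp_loopCondition H₁ fun σ₂ H₂ h10 h11 =>
        ⟨_, ?_, st₁, out₁, q₁, _, _, _, H₂, h10, h11, le_rfl⟩
      have := H₁.prop.le
      omega
    · rw [H.reg8, H.reg9] at hht
      obtain rfl : h = t := by
        have := H.prop.le
        omega
      refine wp_scanNext hP hT H (by omega) fun σ₁ st₁ out₁ q₁ t₁ H₁ hc => ?_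
      refine wp_loopCondition H₁ fun σ₂ H₂ h10 h11 =>
        ⟨_, ?_, st₁, out₁, q₁, _, _, _, H₂, h10, h11, le_rfl⟩
      have := H₁.prop.le
      omega
  have hinit : Meets R loopCondition _ loopCondition.size (I (2 * n)) :=
    .of_wp <| wp_loopCondition h₀ fun σ' H' h10 h11 => by
      refine ⟨st, out, q, 0, 0, 0, H', h10, h11, ?_⟩
      have := unvisited_le st
      omega
  refine (Meets.op_bind rfl <| .op_bind rfl <| .op_bind rfl <| hinit.bind fun σ' hI =>
    ((Meets.loop I hloop hI).mono le_rfl fun σ' hσ' => ?_).bind_skip).mono ?_ fun _ => id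
  · obtain ⟨⟨k, st, out, q, h, t, r, H, h10, h11, -⟩, hlt⟩ := hσ'
    have := H.prop.le
    exact ⟨st, out, q, h, t, r, H, by omega⟩
  · simp only [loopCondition, block, size]
    omega

end

end WeightedBarycenter

/-! ## Correctness of the other phases -/

namespace WeightedBarycenter

open RealRAM RealRAM.Cmd

section

variable {n : ℕ} {γ : Fin n → Plane} {nbr : Fin n → Fin 3 → Fin n}
  {m : ℕ} {σ : Store} {R : Prop} {Q : Store → Prop} {st : Fin n → ℕ} {out : Fin n → Fin 3 → ℝ}

/-! ### Computing the local weights at one vertex. -/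

theorem wp_loadNeighbors (hr : IsRegLayout n m σ.ireg) (hM : IsIndexLayout nbr m st σ.imem)
    (hN : IsRealLayout γ out σ.rmem) {v : Fin n} (hv : σ.ireg 7 = v)
    (hQ : ∀ (f : ℕ → ℕ) (g : ℕ → ℝ), (∀ r < 14, f r = σ.ireg r) →
      g 2 = γ (nbr v 0) 0 - γ v 0 → g 3 = γ (nbr v 0) 1 - γ v 1 →
      g 4 = γ (nbr v 1) 0 - γ v 0 → g 5 = γ (nbr v 1) 1 - γ v 1 →
      g 6 = γ (nbr v 2) 0 - γ v 0 → g 7 = γ (nbr v 2) 1 - γ v 1 →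
      Q { σ with ireg := f, rreg := g }) :
    wp R loadNeighbors σ Q := by
  have e : (v : ℕ) + v + v = 3 * v := by omega
  have e' : 3 * (v : ℕ) + 1 + 1 = 3 * v + 2 := rfl
  have h₀ := hM.nbr v 0
  have h₁ := hM.nbr v 1
  have h₂ := hM.nbr v 2
  have hx (i : Fin n) : σ.rmem (i + i) = γ i 0 := by rw [← hN.pos i 0, two_mul]; rfl
  have hy (i : Fin n) : σ.rmem (i + i + 1) = γ i 1 := by rw [← hN.pos i 1, two_mul]; rfl
  simp only [Fin.isValue, Fin.val_zero, Fin.val_one, Fin.val_two, Nat.add_zero] at h₀ h₁ h₂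
  simp [loadNeighbors, loadDirection, block, wp, Instr.effect, hv, hr.reg2, e, e', h₀, h₁, h₂,
    hx, hy]
  refine hQ _ _ (fun r hr => by simp (disch := omega) only [Function.update_of_ne]) ?_ ?_ ?_ ?_ ?_ ?_
  all_goals simp

theorem wp_computeAreas {v : Fin n}
    (h₂ : σ.rreg 2 = γ (nbr v 0) 0 - γ v 0) (h₃ : σ.rreg 3 = γ (nbr v 0) 1 - γ v 1)
    (h₄ : σ.rreg 4 = γ (nbr v 1) 0 - γ v 0) (h₅ : σ.rreg 5 = γ (nbr v 1) 1 - γ v 1)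
    (h₆ : σ.rreg 6 = γ (nbr v 2) 0 - γ v 0) (h₇ : σ.rreg 7 = γ (nbr v 2) 1 - γ v 1)
    (hQ : ∀ g : ℕ → ℝ, g 8 = areaWeight γ nbr v 0 → g 9 = areaWeight γ nbr v 1 →
      g 10 = areaWeight γ nbr v 2 → Q { σ with rreg := g }) :
    wp R computeAreas σ Q := by
  simp [computeAreas, block, wp, Instr.effect, h₂, h₃, h₄, h₅, h₆, h₇]
  refine hQ _ ?_ ?_ ?_ <;> simp [areaWeight, signedArea]

theorem wp_orientWeights {v : Fin n} (h₈ : σ.rreg 8 = areaWeight γ nbr v 0)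
    (h₉ : σ.rreg 9 = areaWeight γ nbr v 1) (h₁₀ : σ.rreg 10 = areaWeight γ nbr v 2)
    (hQ : ∀ g : ℕ → ℝ, g 11 = 0 → g 8 = orientedWeight γ nbr v 0 →
      g 9 = orientedWeight γ nbr v 1 → g 10 = orientedWeight γ nbr v 2 →
      Q { σ with rreg := g }) :
    wp R orientWeights σ Q := by
  simp [orientWeights, block, wp, Instr.effect, h₈, h₉, h₁₀]
  refine ⟨fun h => hQ _ ?_ ?_ ?_ ?_, fun h => hQ _ ?_ ?_ ?_ ?_⟩
  all_goals simp [orientedWeight, h, h₈, h₉, h₁₀, not_lt.2]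

theorem wp_storeWeights (hr : IsRegLayout n m σ.ireg) (hN : IsRealLayout γ out σ.rmem)
    {v : Fin n} {b : Fin 3 → ℝ} (hv : σ.ireg 7 = v) (h₁₁ : σ.rreg 11 = 0) (h₈ : σ.rreg 8 = b 0)
    (h₉ : σ.rreg 9 = b 1) (h₁₀ : σ.rreg 10 = b 2) (hR : (¬ ∀ k, 0 < b k) → R)
    (hQ : ∀ (f : ℕ → ℕ) (M : ℕ → ℝ), (∀ r < 14, f r = σ.ireg r) → (∀ k, 0 < b k) →
      IsRealLayout γ (Function.update out v b) M → Q { σ with ireg := f, rmem := M }) :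
    wp R storeWeights σ Q := by
  have e : 2 * n + ((v : ℕ) + v + v) = 2 * n + 3 * v := by omega
  have e' : 2 * n + 3 * (v : ℕ) + 1 + 1 = 2 * n + 3 * v + 2 := rfl
  simp [storeWeights, block, wp, Instr.effect, h₁₁, h₈, h₉, h₁₀, hv, hr.reg2, hr.reg6, e, e']
  rw [Fin.forall_fin_succ, Fin.forall_fin_two] at hR
  refine ⟨fun p₀ => ⟨fun p₁ => ⟨fun p₂ => ?_, fun h => hR ?_⟩, fun h => hR ?_⟩, fun h => hR ?_⟩
  · refine hQ _ _ (fun r hr => by simp (disch := omega) only [Function.update_of_ne]) ?_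
      (hN.update_out v b)
    rw [Fin.forall_fin_succ, Fin.forall_fin_two]
    exact ⟨p₀, p₁, p₂⟩
  · exact fun h' => h.not_gt h'.2.2
  · exact fun h' => h.not_gt h'.2.1
  · exact fun h' => h.not_gt h'.1

/-! ### The symmetry check. -/

variable {G : SimpleGraph (Fin n)}

theorem wp_checkEdge (hT : IsNeighborTable G nbr) (hr : IsRegLayout n m σ.ireg)
    (hM : IsIndexLayout nbr m st σ.imem) (hN : IsRealLayout γ out σ.rmem) {u : Fin n}
    (hu : σ.ireg 12 = u) (k : Fin 3)
    (hR : ∀ k', st (nbr u k) < 2 → nbr (nbr u k) k' = u → out u k ≠ out (nbr u k) k' → R)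
    (hQ : ∀ (f : ℕ → ℕ) (g : ℕ → ℝ), (∀ r < 13, f r = σ.ireg r) →
      (∀ k', st (nbr u k) < 2 → nbr (nbr u k) k' = u → out u k = out (nbr u k) k') →
      Q { σ with ireg := f, rreg := g }) :
    wp R (checkEdge k) σ Q := by
  obtain ⟨k', hk'⟩ := hT.exists_reverse u k
  have huniq {l} (hl : nbr (nbr u k) l = u) : l = k' := (hT _).1 (hl.trans hk'.symm)
  refine wp_loadNeighbor hr hM k hu fun f h13 h14 h15 h16 hf => ?_
  have hr' : IsRegLayout n m f := hr.congr fun r hr => hf r (by omega)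
  refine ⟨fun hlt => ?_, fun hlt => ?_⟩
  · refine wp_loadEdge (σ := { σ with ireg := f }) hr' hM hN ((hf 12 (by norm_num)).trans hu) h13
      h14 hk' (hT _).1 fun f' g hg0 hg1 hf' => ?_
    simp only [h16, hr'.reg3] at hlt
    have hne (h : g 0 ≠ g 1) : R := hR k' hlt hk' (by rwa [← hg0, ← hg1])
    refine ⟨fun h => hne h.ne, fun h => ⟨fun h' => hne h'.ne', fun h' => ?_⟩⟩
    refine hQ _ _ (fun r hr => (hf' r (by omega)).trans (hf r hr)) fun l _ hl => ?_
    rw [huniq hl, ← hg0, ← hg1]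
    exact le_antisymm (not_lt.1 h') (not_lt.1 h)
  · refine hQ _ _ hf fun l hl => ?_
    simp only [h16, hr'.reg3] at hlt
    exact absurd hl hlt

theorem wp_checkSymmetricStep (hT : IsNeighborTable G nbr) (hr : IsRegLayout n m σ.ireg)
    (hM : IsIndexLayout nbr m st σ.imem) (hN : IsRealLayout γ out σ.rmem) {u : Fin n}
    (hu : σ.ireg 7 = u)
    (hR : ∀ k k', st u < 2 → st (nbr u k) < 2 → nbr (nbr u k) k' = u →
      out u k ≠ out (nbr u k) k' → R)
    (hQ : ∀ (f : ℕ → ℕ) (g : ℕ → ℝ), IsRegLayout n m f → f 7 = u + 1 →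
      (∀ k k', st u < 2 → st (nbr u k) < 2 → nbr (nbr u k) k' = u →
        out u k = out (nbr u k) k') →
      Q { σ with ireg := f, rreg := g }) :
    wp R checkSymmetricStep σ Q := by
  refine ⟨_, rfl, _, rfl, _, rfl, _, rfl, ?_⟩
  simp [hr.reg4, hu, hM.st]
  set f₀ := Function.update (Function.update σ.ireg 12 u) 14 (st u) with hf₀
  have hr₀ : IsRegLayout n m f₀ := hr.congr fun r hr => by
    simp (disch := omega) only [hf₀, Function.update_of_ne]
  have h12 : f₀ 12 = u := by simp [hf₀]
  have h14 : f₀ 14 = st u := by simp [hf₀]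
  have h7 : f₀ 7 = u := by simpa [hf₀] using hu
  have hlast {f : ℕ → ℕ} (hf : ∀ r < 13, f r = f₀ r) :
      IsRegLayout n m (Function.update f 7 (f 7 + f 2)) ∧
      Function.update f 7 (f 7 + f 2) 7 = u + 1 := by
    have hr₁ := hr₀.congr fun r hr => hf r (by omega)
    refine ⟨hr₁.congr fun r hr => by simp (disch := omega) only [Function.update_of_ne], ?_⟩
    rw [Function.update_self, hr₁.reg2, hf 7 (by norm_num), h7]
  refine ⟨fun hlt => ?_, fun hlt => ?_⟩
  · simp only [h14, hr₀.reg3] at hlt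
    refine wp_checkEdge (σ := { σ with ireg := f₀ }) hT hr₀ hM hN h12 0
      (fun k' => hR 0 k' hlt) fun f₁ g₁ hf₁ h₀ => ?_
    dsimp only at hf₁
    refine wp_checkEdge (σ := ⟨f₁, σ.imem, g₁, σ.rmem⟩) hT
      (hr₀.congr fun r hr => hf₁ r (by omega)) hM hN ((hf₁ 12 (by norm_num)).trans h12) 1
      (fun k' => hR 1 k' hlt) fun f₂ g₂ hf₂ h₁ => ?_
    replace hf₂ : ∀ r < 13, f₂ r = f₀ r := fun r hr => (hf₂ r hr).trans (hf₁ r hr)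
    refine wp_checkEdge (σ := ⟨f₂, σ.imem, g₂, σ.rmem⟩) hT
      (hr₀.congr fun r hr => hf₂ r (by omega)) hM hN ((hf₂ 12 (by norm_num)).trans h12) 2
      (fun k' => hR 2 k' hlt) fun f₃ g₃ hf₃ h₂ => ?_
    obtain ⟨h, h'⟩ := hlast fun r hr => (hf₃ r hr).trans (hf₂ r hr)
    refine ⟨_, rfl, hQ _ _ h h' fun k k' _ => ?_⟩
    fin_cases k
    exacts [h₀ k', h₁ k', h₂ k']
  · simp only [h14, hr₀.reg3] at hlt
    obtain ⟨h, h'⟩ := hlast fun r _ => rfl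
    exact ⟨_, rfl, hQ _ _ h h' fun k k' hu => absurd hu hlt⟩

theorem meets_checkSymmetric (hT : IsNeighborTable G nbr) (hr : IsRegLayout n m σ.ireg)
    (hM : IsIndexLayout nbr m st σ.imem) (hN : IsRealLayout γ out σ.rmem)
    (hR : ∀ u k k', st u < 2 → st (nbr u k) < 2 → nbr (nbr u k) k' = u →
      out u k ≠ out (nbr u k) k' → R) :
    Meets R checkSymmetric σ ((n + 1) * (checkSymmetricStep.size + 2) + 3) fun σ' =>
      IsRealLayout γ out σ'.rmem ∧ ∀ u k k', st u < 2 → st (nbr u k) < 2 →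
        nbr (nbr u k) k' = u → out u k = out (nbr u k) k' := by
  let I (k : ℕ) (σ : Store) : Prop := IsRegLayout n m σ.ireg ∧ IsIndexLayout nbr m st σ.imem ∧
    IsRealLayout γ out σ.rmem ∧ σ.ireg 7 + k = n ∧ ∀ u : Fin n, u < σ.ireg 7 →
      ∀ k k', st u < 2 → st (nbr u k) < 2 → nbr (nbr u k) k' = u → out u k = out (nbr u k) k'
  refine .op_bind rfl ?_
  refine Meets.bind_skip ((Meets.loop I ?_ (k := n)
    (σ := { σ with ireg := Function.update σ.ireg 7 0 }) ⟨hr.congr fun r hr => by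
    simp (disch := omega) only [Function.update_of_ne], hM, hN, by simp, by simp⟩).mono le_rfl ?_)
  · rintro k σ ⟨hr, hM, hN, hk, hs⟩ hlt
    rw [hr.reg0] at hlt
    refine .of_wp (wp_checkSymmetricStep hT hr hM hN (u := ⟨σ.ireg 7, hlt⟩) rfl (hR _)
      fun f g hf h7 hsym => ⟨k - 1, by omega, hf, hM, hN, ?_, fun u hu => ?_⟩)
    · simp only [h7]
      omega
    · by_cases huv : u = ⟨σ.ireg 7, hlt⟩
      · rwa [huv]
      · refine hs u ?_
        have : (u : ℕ) ≠ σ.ireg 7 := fun h => huv (Fin.ext h)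
        simp only [h7] at hu
        omega
  · rintro σ' ⟨⟨k, hr, hM, hN, hk, hs⟩, hlt⟩
    rw [hr.reg0] at hlt
    exact ⟨hN, fun u => hs u (by omega)⟩

/-! ### The loops that compute local weights and mark external vertices. -/

variable [DecidableRel G.Adj]

theorem wp_computeWeightsStep (hP : IsPlanarDrawing G γ) (hT : IsNeighborTable G nbr)
    (hr : IsRegLayout n m σ.ireg) (hM : IsIndexLayout nbr m st σ.imem)
    (hN : IsRealLayout γ out σ.rmem) (hst : ∀ v, st v = 0 ↔ IsInternal G γ v) {v : Fin n}
    (hv : σ.ireg 7 = v)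
    (hQ : ∀ (f : ℕ → ℕ) (g M : ℕ → ℝ) (out' : Fin n → Fin 3 → ℝ), IsRegLayout n m f →
      f 7 = v + 1 → IsRealLayout γ out' M → (∀ u ≠ v, out' u = out u) →
      (IsInternal G γ v → IsBalanced γ nbr v (out' v)) →
      Q { σ with ireg := f, rreg := g, rmem := M }) :
    wp (¬ IsWeightedBarycenterDrawing G γ) computeWeightsStep σ Q := by
  refine ⟨_, rfl, _, rfl, ?_⟩
  simp only [hr.reg4, Function.update_self, hv, hM.st]
  have hr' : IsRegLayout n m (Function.update (Function.update σ.ireg 14 (3 * n + m + v)) 14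
      (st v)) := hr.congr fun r hr => by simp (disch := omega) only [Function.update_of_ne]
  have hlast {f : ℕ → ℕ} (hf : ∀ r < 14, f r = Function.update (Function.update σ.ireg 14
      (3 * n + m + v)) 14 (st v) r) : IsRegLayout n m (Function.update f 7 (f 7 + f 2)) ∧
      Function.update f 7 (f 7 + f 2) 7 = v + 1 := by
    have hr₁ := hr'.congr fun r hr => hf r (by omega)
    refine ⟨hr₁.congr fun r hr => by simp (disch := omega) only [Function.update_of_ne], ?_⟩
    · rw [Function.update_self, hr₁.reg2, hf 7 (by norm_num)]
      simpa using hv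
  refine ⟨fun hi => ?_, fun hi => ?_⟩
  · have hvi : IsInternal G γ v := by
      rw [← hst]
      have := hr.reg2
      simp at hi
      omega
    refine wp_loadNeighbors hr' hM hN (v := v) (by simpa using hv)
      fun f g hf h2 h3 h4 h5 h6 h7 => ?_
    have hr₁ := hr'.congr fun r hr => hf r (by omega)
    refine wp_computeAreas h2 h3 h4 h5 h6 h7 fun g' h8 h9 h10 => ?_
    refine wp_orientWeights h8 h9 h10 fun g'' h11 h8 h9 h10 => ?_
    refine wp_storeWeights (σ := ⟨f, σ.imem, g'', σ.rmem⟩) hr₁ hN (v := v)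
      ((hf 7 (by norm_num)).trans (by simpa using hv)) h11 h8 h9 h10 ?_ fun f' M hf' hpos hN' => ?_
    -- Stopping is justified here: barycenter weights would restrict to balanced weights at `v` and
    -- make the oriented weights positive.
    · rintro hn ⟨w, hw⟩
      exact hn ((hT.isBarycenterWeight_iff.1 hw v hvi).orientedWeight_pos hP (hT.adj v) (hT v).1)
    · obtain ⟨h, h'⟩ := hlast fun r hr => (hf' r hr).trans (hf r hr)
      refine ⟨_, rfl, hQ _ _ _ _ h h' hN' (fun u hu => by rw [Function.update_of_ne hu])
        fun _ => ?_⟩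
      simpa using isBalanced_orientedWeight hpos
  · obtain ⟨h, h'⟩ := hlast fun r hr => rfl
    refine ⟨_, rfl, hQ _ _ _ out h h' hN (fun _ _ => rfl) fun hvi => ?_⟩
    rw [← hst] at hvi
    have := hr.reg2
    simp at hi
    omega

theorem meets_computeWeights (hP : IsPlanarDrawing G γ) (hT : IsNeighborTable G nbr)
    (hr : IsRegLayout n m σ.ireg) (hM : IsIndexLayout nbr m st σ.imem)
    (hN : IsRealLayout γ out σ.rmem) (hst : ∀ v, st v = 0 ↔ IsInternal G γ v)
    (h7 : σ.ireg 7 = 0) :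
    Meets (¬ IsWeightedBarycenterDrawing G γ) computeWeights σ
      ((n + 1) * (computeWeightsStep.size + 2) + 2) fun σ' =>
      ∃ out, IsRegLayout n m σ'.ireg ∧ IsIndexLayout nbr m st σ'.imem ∧
        IsRealLayout γ out σ'.rmem ∧ ∀ v, IsInternal G γ v → IsBalanced γ nbr v (out v) := by
  let I (k : ℕ) (σ : Store) : Prop := IsRegLayout n m σ.ireg ∧ IsIndexLayout nbr m st σ.imem ∧
    σ.ireg 7 + k = n ∧ ∃ out, IsRealLayout γ out σ.rmem ∧
      ∀ v : Fin n, v < σ.ireg 7 → IsInternal G γ v → IsBalanced γ nbr v (out v)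
  refine (Meets.loop I ?_ (k := n) ⟨hr, hM, by omega, out, hN, fun v hv => by omega⟩).mono le_rfl ?_
  · rintro k σ ⟨hr, hM, hk, out, hN, hb⟩ hlt
    rw [hr.reg0] at hlt
    refine .of_wp (wp_computeWeightsStep hP hT hr hM hN hst (v := ⟨σ.ireg 7, hlt⟩) rfl
      fun f g M out' hf h7 hN' hout hbal => ⟨k - 1, by omega, hf, hM, ?_, out', hN', fun u hu => ?_⟩)
    · simp only [h7]
      omega
    · by_cases huv : u = ⟨σ.ireg 7, hlt⟩
      · rwa [huv]
      · rw [hout u huv]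
        refine hb u ?_
        have : (u : ℕ) ≠ σ.ireg 7 := fun h => huv (Fin.ext h)
        simp only [h7] at hu
        omega
  · rintro σ' ⟨⟨k, hr, hM, hk, out, hN, hb⟩, hlt⟩
    rw [hr.reg0] at hlt
    exact ⟨out, hr, hM, hN, fun v => hb v (by omega)⟩

theorem meets_markExternal (outer : List (Fin n)) (hr : IsRegLayout n outer.length σ.ireg)
    (h13 : σ.ireg 13 = 3 * n) (h7 : σ.ireg 7 = 0)
    (hM : IsIndexLayout nbr outer.length (fun _ => 0) σ.imem)
    (ho : ∀ l (h : l < outer.length), σ.imem (3 * n + l) = outer[l]) :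
    Meets R markExternal σ ((outer.length + 1) * (markExternalStep.size + 2) + 2) fun σ' =>
      IsRegLayout n outer.length σ'.ireg ∧
      IsIndexLayout nbr outer.length (fun v => if v ∈ outer then 2 else 0) σ'.imem ∧
      σ'.rmem = σ.rmem := by
  let I (k : ℕ) (σ' : Store) : Prop := IsRegLayout n outer.length σ'.ireg ∧
    σ'.ireg 13 = 3 * n ∧ σ'.ireg 7 + k = outer.length ∧
    IsIndexLayout nbr outer.length (fun v => if v ∈ outer.take (σ'.ireg 7) then 2 else 0) σ'.imem ∧
    (∀ l (h : l < outer.length), σ'.imem (3 * n + l) = outer[l]) ∧ σ'.rmem = σ.rmem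
  refine (Meets.loop I ?_ (k := outer.length) ⟨hr, h13, by omega, by simpa [h7] using hM, ho,
    rfl⟩).mono le_rfl ?_
  · rintro k σ' ⟨hr, h13, hk, hM, ho, hN⟩ hlt
    rw [hr.reg1] at hlt
    have ho7 := ho _ hlt
    refine .of_wp ?_
    simp [markExternalStep, block, wp, Instr.effect, h13, ho7, hr.reg2, hr.reg3, hr.reg4]
    refine ⟨k - 1, by omega, hr.congr fun r hr => by
      simp (disch := omega) only [Function.update_of_ne], ?_, ?_, ?_, fun l hl => ?_, hN⟩
    · simpa using h13
    · simp
      omega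
    · convert hM.update_st outer[σ'.ireg 7] 2 using 1
      funext v
      simp only [Function.update_self, ← List.take_concat_get' _ _ hlt, List.mem_append,
        List.mem_singleton, Function.update_apply]
      split_ifs <;> tauto
    · dsimp only
      rw [Function.update_of_ne (by omega), ho l hl]
  · rintro σ' ⟨⟨k, hr, h13, hk, hM, ho, hN⟩, hlt⟩
    rw [hr.reg1] at hlt
    refine ⟨hr, ?_, hN⟩
    rwa [List.take_of_length_le (by omega)] at hM

end

/-! ## The recognition theorem -/

section

variable {n : ℕ} {G : SimpleGraph (Fin n)} {γ : Fin n → Plane} {nbr : Fin n → Fin 3 → Fin n}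
  {outer : List (Fin n)}

theorem inputReal_pos (γ : Fin n → Plane) (i : Fin n) (d : Fin 2) :
    inputReal γ (2 * i + d) = γ i d := by
  have h : (2 * (i : ℕ) + d) / 2 = i := by omega
  have h' : (2 * (i : ℕ) + d) % 2 = d := by omega
  simp [inputReal, h, h']

theorem inputIndex_nbr (i : Fin n) (k : Fin 3) : inputIndex nbr outer (3 * i + k) = nbr i k := by
  have h : (3 * (i : ℕ) + k) / 3 = i := by omega
  have h' : (3 * (i : ℕ) + k) % 3 = k := by omega
  simp [inputIndex, h, h']

theorem inputIndex_outer {l : ℕ} (hl : l < outer.length) :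
    inputIndex nbr outer (3 * n + l) = outer[l] := by
  have h : ¬ (3 * n + l) / 3 < n := by omega
  simp [inputIndex, h, hl]

theorem inputIndex_of_le {a : ℕ} (ha : 3 * n + outer.length ≤ a) :
    inputIndex nbr outer a = 0 := by
  have h : ¬ a / 3 < n := by omega
  have h' : ¬ a - 3 * n < outer.length := by omega
  simp [inputIndex, h, h']

variable [DecidableRel G.Adj]

/-- A bound for the running time of the recognition algorithm, per vertex. -/
def timeBound : ℕ :=
  2 * markExternalStep.size + 2 * computeWeightsStep.size + 3 * propagateStep.size +
    2 * checkSymmetricStep.size + 100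

theorem meets_recognition (hn : 0 < n) (hP : IsPlanarDrawing G γ) (hT : IsNeighborTable G nbr)
    (hO : IsOuterFaceList G γ outer) {σ : Store}
    (h₀ : σ.ireg 0 = n) (h₁ : σ.ireg 1 = outer.length) (hM : σ.imem = inputIndex nbr outer)
    (hN : σ.rmem = inputReal γ) :
    Meets (¬ IsWeightedBarycenterDrawing G γ) recognition σ (timeBound * n) fun σ' =>
      ∃ out, IsRealLayout γ out σ'.rmem ∧
        (∀ v, IsInternal G γ v → IsBalanced γ nbr v (out v)) ∧
        ∀ u k k', IsInternal G γ u → IsInternal G γ (nbr u k) → nbr (nbr u k) k' = u →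
          out u k = out (nbr u k) k' := by
  have hlen : outer.length ≤ n := by simpa using hO.1.length_le_card
  set st : Fin n → ℕ := fun v => if v ∈ outer then 2 else 0 with hst
  have hst0 (v : Fin n) : st v = 0 ↔ IsInternal G γ v := by
    simp [hst, IsInternal, ← hO.2]
  have hst' (v : Fin n) : st v = 0 ∨ st v = 2 := by
    simp only [hst]
    split_ifs <;> simp
  have hinit : Meets (¬ IsWeightedBarycenterDrawing G γ) initRegs σ initRegs.size fun σ' =>
      IsRegLayout n outer.length σ'.ireg ∧ σ'.ireg 13 = 3 * n ∧ σ'.ireg 7 = 0 ∧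
        σ'.imem = inputIndex nbr outer ∧ σ'.rmem = inputReal γ := by
    refine .of_wp ?_
    simp [initRegs, block, wp, Instr.effect, h₀, h₁, hM, hN]
    refine ⟨?_, by ring⟩
    constructor <;> simp [h₀, h₁] <;> ring
  refine (hinit.bind fun σ₁ ⟨hr, h13, h7, hM, hN⟩ => (meets_markExternal (nbr := nbr) outer hr h13
    h7 ⟨?_, ?_⟩ ?_).bind (T' := (n + 1) * (computeWeightsStep.size + 2) + 2 +
      ((2 * n + 1) * (propagateStep.size + 2) + 7 +
      ((n + 1) * (checkSymmetricStep.size + 2) + 3)) + 1)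
      fun σ₂ ⟨hr, hM, hN'⟩ => .op_bind rfl ?_).mono ?_ fun _ => id
  · intro i k
    rw [hM, inputIndex_nbr]
  · intro v
    rw [hM, inputIndex_of_le (by omega)]
  · intro l hl
    rw [hM, inputIndex_outer hl]
  -- Nothing is known or needed about the weight cells yet, so `out` is whatever they contain.
  · refine (meets_computeWeights hP hT (σ := { σ₂ with ireg := Function.update σ₂.ireg 7 0 })
      (out := fun i k => σ₂.rmem (2 * n + 3 * i + k))
      (hr.congr fun r hr => by simp (disch := omega) only [Function.update_of_ne]) hM
      ⟨fun i d => ?_, fun _ _ => rfl⟩ hst0 (by simp)).bind fun σ₃ ⟨out, hr, hM, hN, hb⟩ => ?_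
    · rw [hN', hN, inputReal_pos]
    · refine (meets_propagate hP hT (fun _ => ⟨0, hn⟩) hr hM hN hst' hst0 hb).bind
        fun σ₄ ⟨st', out', q, h, t, r, H, hnr⟩ => Meets.bind_skip ?_
      refine (meets_checkSymmetric hT H.regs H.index H.real
        fun u k k' hu hv hk hne hd => hne (H.prop.symmetric hnr hd hu hv rfl hk)).mono le_rfl
        fun σ₅ ⟨hN, hs⟩ => ⟨out', hN, H.prop.balanced, ?_⟩
      simpa only [H.prop.internal] using hs
  · rw [show initRegs.size = 7 from rfl, timeBound]
    generalize markExternalStep.size = a, computeWeightsStep.size = b, propagateStep.size = c,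
      checkSymmetricStep.size = d
    -- Since `1 ≤ n`, each `n + 1` is at most `2 * n` and `2 * n + 1` at most `3 * n`. The remaining
    -- `18 * n + 22` steps fit into the constant 100.
    have ha : (outer.length + 1) * (a + 2) ≤ 2 * n * (a + 2) := by gcongr; omega
    have hb : (n + 1) * (b + 2) ≤ 2 * n * (b + 2) := by gcongr; omega
    have hc : (2 * n + 1) * (c + 2) ≤ 3 * n * (c + 2) := by gcongr; omega
    have hd : (n + 1) * (d + 2) ≤ 2 * n * (d + 2) := by gcongr; omega
    linarith

end

end WeightedBarycenter

theorem mainTheorem5 :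
    ∃ (P : RealRAM.Program) (c : ℕ),
      ∀ (n : ℕ) (G : SimpleGraph (Fin n)) [DecidableRel G.Adj]
        (γ : Fin n → WeightedBarycenter.Plane)
        (nbr : Fin n → Fin 3 → Fin n) (outer : List (Fin n)),
        WeightedBarycenter.IsRecognitionInput G γ →
        G.IsRegularOfDegree 3 →
        WeightedBarycenter.IsNeighborTable G nbr →
        WeightedBarycenter.IsOuterFaceList G γ outer →
        ∃ (t : ℕ) (answer : Bool) (s : RealRAM.State),
          t ≤ c * n ∧
          RealRAM.HaltsIn P (WeightedBarycenter.initialState γ nbr outer) t answer s ∧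
          (answer = true ↔ WeightedBarycenter.IsWeightedBarycenterDrawing G γ) ∧
          (answer = true → ∃ w : Sym2 (Fin n) → ℝ,
            WeightedBarycenter.IsBarycenterWeight G γ w ∧
            WeightedBarycenter.OutputsWeights G γ nbr w s) := by
  open WeightedBarycenter RealRAM RealRAM.Cmd in
  refine ⟨recognitionProgram, timeBound, fun n G _ γ nbr outer hI _ hT hO => ?_⟩
  -- A vertex is needed as default queue entry, and `0 < n` lets the additive constants be absorbed
  -- into `c * n`.
  have hn : 0 < n := by
    have := hI.triconnected.1
    rw [Fintype.card_fin] at this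
    omega
  obtain ⟨t, ht, h⟩ := WeightedBarycenter.meets_recognition hn hI.planar hT hO
    (σ := ⟨fun r => if r = 0 then n else if r = 1 then outer.length else 0,
      WeightedBarycenter.inputIndex nbr outer, fun _ => 0, WeightedBarycenter.inputReal γ⟩)
    -- The compiled command sits at position 0 and is followed by `halt true`, so reaching its end
    -- is accepting.
    rfl rfl rfl rfl WeightedBarycenter.recognitionProgram 0 ⟨[], [.halt true], rfl, rfl⟩
  rcases h with ⟨σ', hrun, out, hN, hb, hs⟩ | ⟨hR, s, hs⟩
  · obtain ⟨w, hw, hout⟩ := WeightedBarycenter.exists_isBarycenterWeight hT hb hs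
    refine ⟨t, true, _, ht, ⟨hrun, ?_⟩, by simpa using ⟨w, hw⟩, fun _ => ⟨w, hw, fun i hi k => ?_⟩⟩
    · simp [RealRAM.Store.at, WeightedBarycenter.recognitionProgram]
    · rw [← hout i hi]
      exact hN.out i k
  · exact ⟨t, false, s, ht, hs, by simpa using hR, by simp⟩
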